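/- For $s,w\in\mathbb C$ let $(s)_w=\Gamma(s+w)/\Gamma(s)$, and let ${}_2F_1=F$ and ${}_3F_2$ denote the generalized hypergeometric functions (sums of the hypergeometric series for $|z|<1$, continued analytically in $z$ to $\mathbb C\setminus[1,\infty)$). For $-\gamma\notin\mathbb N_0$ the sine-modulated incomplete hypergeometric function is $$\mathcal F(\alpha,\beta;\gamma;z)_\nu = F(\alpha,\beta;\gamma;z)-\frac{(\alpha)_\nu\,(-z)^\nu}{(1)_\nu\,(1-\beta)_{-\nu}\,(\gamma)_\nu}\;{}_3F_2\!\left(1,\alpha+\nu,\beta+\nu;\,1+\nu,\gamma+\nu;\,z\right),$$ where for $\alpha=1$ and $\nu\in\{-1,-2,\dots\}$ the factors $(\alpha)_\nu$ and $(1)_\nu$, and likewise the parameters $\alpha+\nu$ and $1+\nu$ of the ${}_3F_2$, cancel, and where $1/(1-\beta)_{-\nu}$ is read as $0$ at a pole of $(1-\beta)_{-\nu}$. **Theorem.** Let $\alpha_1,\alpha_2>0$ with $\alpha_1+\alpha_2>1$, let $\kappa_1,\kappa_2>0$ with $\kappa_1\ne\kappa_2$, and put $\zeta=\kappa_2/\kappa_1$.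 Let $Y_1,Y_2$ be independent random variables, $Y_i$ having the gamma distribution with shape $\alpha_i$ and rate $\alpha_i/\kappa_i$. Let $\nu\in\mathbb C$ with $-\alpha_2<\operatorname{Re}\nu<\alpha_1$. Then $$\mathscr T_\nu=\frac{\alpha_1-1}{\alpha_1Y_1}\,\mathcal F\!\left(1,2-\alpha_1;\alpha_2;-\frac{\alpha_2Y_2}{\alpha_1Y_1}\right)_{\!\nu}$$ (for $\alpha_1=1$, where this expression is indeterminate, $\mathscr T_\nu$ is its limit as the shape parameter $\alpha_1$ tends to $1$, with $\alpha_2,\nu,Y_1,Y_2$ fixed) is an unbiased estimator of $\tau_\nu=(1-\zeta^\nu)/(\kappa_1-\kappa_2)$; that is, $\mathscr T_\nu$ is integrable and $$\mathbb E\,\mathscr T_\nu=\frac{1-\zeta^\nu}{\kappa_1-\kappa_2}.$$ -/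

import Mathlib

open MeasureTheory ProbabilityTheory Filter Topology

noncomputable section

open Classical in
/-- The analytic continuation to the point `z`, along the straight segment from `0` to `z`, of the
function `f` given near `0` (and `0` if there is none). Where the only singularity is at `1`, this
is the principal branch on the complex plane cut along `[1, ∞)`. -/
def segmentContinuation (f : ℂ → ℂ) (z : ℂ) : ℂ :=
  if h : ∃ g : ℂ → ℂ, AnalyticOnNhd ℂ g (segment ℝ 0 z) ∧ g =ᶠ[𝓝 0] f then h.choose z else 0

/-- The continuation does not depend on the choice of the continuing function. -/
theorem segmentContinuation_eq {f g : ℂ → ℂ} {z : ℂ}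
    (hg : AnalyticOnNhd ℂ g (segment ℝ 0 z)) (hgf : g =ᶠ[𝓝 0] f) :
    segmentContinuation f z = g z := by
  have h : ∃ g : ℂ → ℂ, AnalyticOnNhd ℂ g (segment ℝ 0 z) ∧ g =ᶠ[𝓝 0] f := ⟨g, hg, hgf⟩
  rw [segmentContinuation, dif_pos h]
  exact h.choose_spec.1.eqOn_of_preconnected_of_eventuallyEq hg
    (convex_segment (𝕜 := ℝ) (0 : ℂ) z).isPreconnected (left_mem_segment ℝ 0 z)
    (h.choose_spec.2.trans hgf.symm) (right_mem_segment ℝ 0 z)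

/-- The Pochhammer symbol `(s)_w = Γ(s + w) / Γ(s)` with complex index. -/
def pochhammerSymbol (s w : ℂ) : ℂ := Complex.Gamma (s + w) / Complex.Gamma s

/-- The generalized hypergeometric function `pFq(a; b; z)`, for `p = q + 1`, no entry of `b` a
nonpositive integer and `z ∉ [1, ∞)`: the analytic continuation of the generalized hypergeometric
series. Mathlib's `Complex.regularizedHGFun` is the sum of the series divided by `∏ Γ(b_j)`. -/
def genHypergeometric (a b : Multiset ℂ) (z : ℂ) : ℂ :=
  (b.map Complex.Gamma).prod * segmentContinuation (Complex.regularizedHGFun a b) z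

open Classical in
/-- The sine-modulated incomplete hypergeometric function `𝓕(α, β; γ; z)_ν`.

The second branch is the defining formula. It has a removable singularity if `α = 1` and
`ν = -1, -2, …`: there `(α)_ν` and `(1)_ν` cancel, and so do the numerator parameter `α + ν` and the
denominator parameter `1 + ν` of the `₃F₂`; the first branch is the formula after this cancellation.
At a pole of `(1 - β)_{-ν}` the quotient by it is `0`, which is what the code computes, as Mathlib's
`Γ` is `0` at its poles and `x / 0 = 0`. -/
def sineModHypergeometric (α β γ z ν : ℂ) : ℂ :=
  genHypergeometric {α, β} {γ} z -
    if α = 1 ∧ ∃ m : ℕ, ν = -((m : ℂ) + 1) then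
      (-z) ^ ν / (pochhammerSymbol (1 - β) (-ν) * pochhammerSymbol γ ν) *
        genHypergeometric {1, β + ν} {γ + ν} z
    else
      pochhammerSymbol α ν * (-z) ^ ν /
          (pochhammerSymbol 1 ν * pochhammerSymbol (1 - β) (-ν) * pochhammerSymbol γ ν) *
        genHypergeometric {1, α + ν, β + ν} {1 + ν, γ + ν} z

/-- The formula `(α₁ - 1) / (α₁ y₁) * 𝓕(1, 2 - α₁; α₂; - α₂ y₂ / (α₁ y₁))_ν`. -/
def estimatorFormula (α₁ α₂ : ℝ) (ν : ℂ) (y₁ y₂ : ℝ) : ℂ :=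
  ((α₁ : ℂ) - 1) / ((α₁ : ℂ) * (y₁ : ℂ)) *
    sineModHypergeometric 1 (2 - (α₁ : ℂ)) (α₂ : ℂ)
      (-(((α₂ : ℂ) * (y₂ : ℂ)) / ((α₁ : ℂ) * (y₁ : ℂ)))) ν

/-- The estimator `T_ν`. At `α₁ = 1` the formula is an indeterminate product of `α₁ - 1 = 0` with
the pole of `1 / (α₁ - 1)_{-ν}`, and `T_ν` is its limit as the shape parameter tends to `1`. -/
def estimatorT (α₁ α₂ : ℝ) (ν : ℂ) (y₁ y₂ : ℝ) : ℂ :=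
  if α₁ = 1 then limUnder (𝓝[≠] (1 : ℝ)) (fun a => estimatorFormula a α₂ ν y₁ y₂)
  else estimatorFormula α₁ α₂ ν y₁ y₂

end

open Set Complex

/-! Put `a = α₂ - 1 + s`, `b = α₁ - 1 - s` and `t = α₂ Y₂ / (α₁ Y₁)`. Since `(1 - b)_n / Γ(b) =
(-1)^n / Γ(b - n)`, both hypergeometric terms of the estimator are instances of one function: with
`g(z) = ∑ (-z)^n / (Γ(b - n) Γ(a + 1 + n))`, continued to the cut plane, the estimator is `term(0) -
term(ν)`, where `term(s) = Γ(α₁) Γ(α₂) / (α₁ Y₁) * t^s * g(-t)` (`estimatorFormula_eq`,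
`estimatorT_eq`).

The series solves a first-order linear equation, hence has a closed form with one Euler integral
(`binomialTail`, `binomialTail_eq`). This form is regular at `α₁ = 1`, gives the size of `g` on the
negative axis, and makes integrals over the half-line computable.

In the coordinates `(Y₁, t)` the density of `(Y₁, Y₂)`, multiplied by `1 / Y₁`, contains `Y₁` only
through a Gamma kernel. Integrating it out leaves, with `c = α₁ + α₂ - 1 = a + b + 1` and `ζ = κ₂ /
κ₁`, the transform `∫ (ζ + t)^(-c) t^a g(-t) dt` over `(0, ∞)`. An explicit primitive and the Beta
integral evaluate it as `(1 - ζ^(-b)) / ((ζ - 1) Γ(c))` (`integral_rpow_mul_binomialTail`).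
Convergence needs `Re a > -1`, `Re b > -1` and `c > 0`, which are the conditions `-α₂ < Re s`, `Re s
< α₁` and `α₁ + α₂ > 1`.

So `term(s)` has mean `(ζ^α₁ - ζ^(1 + s)) / (κ₂ (ζ - 1))`. The part with `ζ^α₁` does not depend on
`s` and cancels between `s = 0` and `s = ν`, leaving `(1 - ζ^ν) / (κ₁ - κ₂)`. -/

/-! ### The Euler integral on the cut plane. -/

/-- The Euler-type integral `∫₀¹ v ^ a (1 - z v) ^ (-k) dv`. -/
noncomputable def eulerIntegral (a k z : ℂ) : ℂ :=
  ∫ v in (0 : ℝ)..1, (v : ℂ) ^ a * (1 - z * v) ^ (-k)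

theorem one_sub_mul_mem_slitPlane {z : ℂ} (hz : 1 - z ∈ slitPlane) {v : ℝ} (hv : v ∈ Icc (0 : ℝ) 1) :
    1 - z * v ∈ slitPlane := by
  have := starConvex_one_slitPlane hz (sub_nonneg.2 hv.2) hv.1 (by ring)
  convert this using 1
  simp only [real_smul]
  push_cast
  ring

theorem continuousOn_one_sub_mul_cpow (k : ℂ) {s : Set ℂ} (hs : ∀ z ∈ s, 1 - z ∈ slitPlane) :
    ContinuousOn (fun p : ℂ × ℝ => (1 - p.1 * p.2) ^ k) (s ×ˢ Icc 0 1) := by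
  refine ContinuousOn.cpow (by fun_prop) continuousOn_const ?_
  rintro ⟨z, v⟩ ⟨hz, hv⟩
  exact one_sub_mul_mem_slitPlane (hs z hz) hv

theorem continuousOn_one_sub_mul_cpow_right (k : ℂ) {z : ℂ} (hz : 1 - z ∈ slitPlane) :
    ContinuousOn (fun v : ℝ => (1 - z * v) ^ k) (Icc 0 1) := by
  refine ContinuousOn.cpow (by fun_prop) continuousOn_const ?_
  intro v hv
  exact one_sub_mul_mem_slitPlane hz hv

theorem intervalIntegrable_eulerIntegral {a k z : ℂ} (ha : -1 < a.re) (hz : 1 - z ∈ slitPlane) :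
    IntervalIntegrable (fun v : ℝ => (v : ℂ) ^ a * (1 - z * v) ^ (-k)) volume 0 1 := by
  refine (intervalIntegral.intervalIntegrable_cpow' ha).mul_continuousOn ?_
  rw [uIcc_of_le zero_le_one]
  exact continuousOn_one_sub_mul_cpow_right _ hz

theorem hasDerivAt_eulerIntegral {a k z : ℂ} (ha : -1 < a.re) (hz : 1 - z ∈ slitPlane) :
    HasDerivAt (eulerIntegral a k) (k * eulerIntegral (a + 1) (k + 1) z) z := by
  have hopen : IsOpen {z : ℂ | 1 - z ∈ slitPlane} :=
    isOpen_slitPlane.preimage (by fun_prop)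
  obtain ⟨ε, hε, hball⟩ := Metric.nhds_basis_closedBall.mem_iff.1 (hopen.mem_nhds hz)
  have hcont := continuousOn_one_sub_mul_cpow (-(k + 1)) hball
  obtain ⟨C, hC⟩ := ((isCompact_closedBall z ε).prod isCompact_Icc).exists_bound_of_continuousOn hcont
  have key := intervalIntegral.hasDerivAt_integral_of_dominated_loc_of_deriv_le
    (μ := volume) (a := 0) (b := 1) (x₀ := z)
    (F := fun z (v : ℝ) => (v : ℂ) ^ a * (1 - z * v) ^ (-k))
    (F' := fun z (v : ℝ) => (v : ℂ) ^ a * (k * v * (1 - z * v) ^ (-(k + 1))))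
    (bound := fun v : ℝ => ‖(v : ℂ) ^ a‖ * (‖k‖ * C))
    (Metric.closedBall_mem_nhds z hε) ?_ (intervalIntegrable_eulerIntegral ha hz) ?_ ?_ ?_ ?_
  · have e : (∫ v in (0 : ℝ)..1, (v : ℂ) ^ a * (k * v * (1 - z * v) ^ (-(k + 1)))) =
        k * eulerIntegral (a + 1) (k + 1) z := by
      rw [eulerIntegral, ← intervalIntegral.integral_const_mul]
      refine intervalIntegral.integral_congr_uIoo fun v hv => ?_
      rw [uIoo_of_le zero_le_one] at hv
      rw [cpow_add _ _ (ofReal_ne_zero.2 hv.1.ne'), cpow_one]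
      ring
    rw [← e]
    exact key.2
  · filter_upwards [hopen.mem_nhds hz] with w hw
    have := intervalIntegrable_eulerIntegral (k := k) ha hw
    rw [intervalIntegrable_iff] at this
    exact this.1
  · have : IntervalIntegrable (fun v : ℝ => (v : ℂ) ^ a * (k * v * (1 - z * v) ^ (-(k + 1))))
        volume 0 1 := by
      refine (intervalIntegral.intervalIntegrable_cpow' ha).mul_continuousOn ?_
      rw [uIcc_of_le zero_le_one]
      exact ContinuousOn.mul (by fun_prop) (continuousOn_one_sub_mul_cpow_right _ hz)
    rw [intervalIntegrable_iff] at this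
    exact this.1
  · refine ae_of_all _ fun v hv w hw => ?_
    rw [uIoc_of_le zero_le_one] at hv
    rw [norm_mul, norm_mul, norm_mul]
    have h1 := hC (w, v) ⟨hw, hv.1.le, hv.2⟩
    have h2 : ‖(v : ℂ)‖ ≤ 1 := by
      rw [norm_real, Real.norm_of_nonneg hv.1.le]; exact hv.2
    refine mul_le_mul_of_nonneg_left ?_ (norm_nonneg _)
    calc ‖k‖ * ‖(v : ℂ)‖ * ‖(1 - w * v) ^ (-(k + 1))‖ ≤ ‖k‖ * 1 * C := by gcongr
      _ = ‖k‖ * C := by ring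
  · exact (intervalIntegral.intervalIntegrable_cpow' ha).norm.mul_const _
  · refine ae_of_all _ fun v hv w hw => ?_
    rw [uIoc_of_le zero_le_one] at hv
    have h1 : HasDerivAt (fun w : ℂ => 1 - w * v) (-(v : ℂ)) w := by
      simpa using ((hasDerivAt_id w).mul_const (v : ℂ)).const_sub 1
    have h2 := (h1.cpow_const (c := -k)
      (one_sub_mul_mem_slitPlane (hball hw) ⟨hv.1.le, hv.2⟩)).const_mul ((v : ℂ) ^ a)
    refine h2.congr_deriv ?_
    rw [neg_add']
    ring

/-- Integration by parts for `eulerIntegral`. -/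
theorem eulerIntegral_recurrence {a k z : ℂ} (ha : -1 < a.re) (hz : 1 - z ∈ slitPlane) :
    (a + 1) * eulerIntegral a k z + z * (k * eulerIntegral (a + 1) (k + 1) z) = (1 - z) ^ (-k) := by
  have ha1 : 0 < (a + 1).re := by simp; linarith
  have hi := intervalIntegrable_eulerIntegral (k := k) ha hz
  have hi' := intervalIntegrable_eulerIntegral (k := k + 1) (a := a + 1) (by linarith) hz
  have key := intervalIntegral.integral_eq_sub_of_hasDerivAt_of_le (a := (0 : ℝ)) (b := 1)
    (f := fun v : ℝ => (v : ℂ) ^ (a + 1) * (1 - z * v) ^ (-k))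
    (f' := fun v : ℝ => (a + 1) * ((v : ℂ) ^ a * (1 - z * v) ^ (-k)) +
      z * (k * ((v : ℂ) ^ (a + 1) * (1 - z * v) ^ (-(k + 1))))) zero_le_one ?_ ?_ ?_
  · rw [intervalIntegral.integral_add, intervalIntegral.integral_const_mul,
      intervalIntegral.integral_const_mul, intervalIntegral.integral_const_mul] at key
    · rw [eulerIntegral, eulerIntegral, key]
      have : a + 1 ≠ 0 := fun h => by simp [h] at ha1
      simp [zero_cpow this]
    · exact hi.const_mul _
    · exact (hi'.const_mul _).const_mul _
  · refine ContinuousOn.mul ?_ (continuousOn_one_sub_mul_cpow_right _ hz)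
    exact (continuous_ofReal_cpow_const ha1).continuousOn
  · intro v hv
    have h1 : HasDerivAt (fun v : ℝ => 1 - z * (v : ℂ)) (-z) v := by
      simpa using ((hasDerivAt_id v).ofReal_comp.const_mul z).const_sub 1
    have h2 : HasDerivAt (fun v : ℝ => (1 - z * (v : ℂ)) ^ (-k))
        (-k * (1 - z * v) ^ (-k - 1) * (-z)) v := by
      have := (hasDerivAt_id (1 - z * (v : ℂ))).cpow_const (c := -k)
        (one_sub_mul_mem_slitPlane hz ⟨hv.1.le, hv.2.le⟩)
      rw [mul_one] at this
      exact HasDerivAt.comp v this h1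
    have h3 : HasDerivAt (fun v : ℝ => (v : ℂ) ^ (a + 1)) ((a + 1) * (v : ℂ) ^ a) v := by
      have h : a + 1 ≠ 0 := fun h => by simp [h] at ha1
      simpa using hasDerivAt_ofReal_cpow_const hv.1.ne' h
    refine (h3.mul h2).congr_deriv ?_
    rw [neg_add']
    ring
  · exact (hi.const_mul _).add ((hi'.const_mul _).const_mul _)

/-! ### The closed form and its differential equation. -/

/-- The analytic continuation of `∑ n, (-z) ^ n / (Γ (b - n) Γ (a + 1 + n))`. -/
noncomputable def binomialTail (a b z : ℂ) : ℂ :=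
  ((b + a * z) / (1 - z) ^ 2 -
    (a + b + 1) * (a + b) * ((1 - z) ^ (a + b - 1) * (z * eulerIntegral a (a + b + 2) z))) *
      ((Gamma (a + 1))⁻¹ * (Gamma (b + 1))⁻¹)

/-- Variation of constants gives the solution `z^(-a) (1 - z)^(a + b - 1) ∫₀^z a b u^(a - 1) (1 -
u)^(-(a + b)) du`, which needs `Re a > 0`. Integrating by parts raises the exponent of `u` to `a`; a
second integration by parts raises that of `1 / (1 - u)` to `a + b + 2` and absorbs the factor `b`.
The result is `binomialTail`: it makes sense for `Re a > -1`, and its integrand stays integrable up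
to `u = -∞` when `Re b > -1`. -/
theorem binomialTail_hasDerivAt {a b z : ℂ} (ha : -1 < a.re) (hz : 1 - z ∈ slitPlane) :
    ∃ g', HasDerivAt (binomialTail a b) g' z ∧
      z * (1 - z) * g' + (a + z * (b - 1)) * binomialTail a b z =
        a * b * ((Gamma (a + 1))⁻¹ * (Gamma (b + 1))⁻¹) := by
  have h0 : 1 - z ≠ 0 := slitPlane_ne_zero hz
  have hL := (hasDerivAt_id z).mul (hasDerivAt_eulerIntegral (k := a + b + 2) ha hz)
  have h1 : HasDerivAt (fun w : ℂ => 1 - w) (-1) z := by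
    simpa using (hasDerivAt_id z).const_sub 1
  have hp := h1.cpow_const (c := a + b - 1) hz
  have hN : HasDerivAt (fun w : ℂ => b + a * w) a z := by
    simpa using ((hasDerivAt_id z).const_mul a).const_add b
  have hq := hN.div (h1.pow 2) (pow_ne_zero 2 h0)
  have key := (hq.sub ((hp.mul hL).const_mul ((a + b + 1) * (a + b)))).mul_const
    ((Gamma (a + 1))⁻¹ * (Gamma (b + 1))⁻¹)
  refine ⟨_, key, ?_⟩
  have hrec := eulerIntegral_recurrence (k := a + b + 2) ha hz
  have e1 : (1 - z) ^ (a + b - 1) = (1 - z) ^ (a + b - 1 - 1) * (1 - z) := by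
    rw [cpow_sub (a + b - 1) 1 h0, cpow_one, div_mul_cancel₀ _ h0]
  -- The only relation between the complex powers that is needed; after it the claim is rational in
  -- the remaining quantities.
  have e2 : (1 - z) ^ (a + b - 1 - 1) * (1 - z) ^ (-(a + b + 2)) = 1 / (1 - z) ^ 4 := by
    rw [← cpow_add _ _ h0, show a + b - 1 - 1 + -(a + b + 2) = -((4 : ℕ) : ℂ) by push_cast; ring,
      cpow_neg, cpow_natCast, one_div]
  rw [← hrec, eq_div_iff (pow_ne_zero 4 h0)] at e2
  simp only [binomialTail, Pi.pow_apply, Pi.mul_apply, id, e1]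
  clear e1 hrec hq hp hL hN h1 key hz
  generalize (1 - z) ^ (a + b - 1 - 1) = E at *
  generalize (Gamma (a + 1))⁻¹ * (Gamma (b + 1))⁻¹ = G at *
  generalize eulerIntegral a (a + b + 2) z = M at *
  generalize eulerIntegral (a + 1) (a + b + 2 + 1) z = M' at *
  obtain ⟨p, rfl⟩ : ∃ p, z = 1 - p := ⟨1 - z, by ring⟩
  simp only [sub_sub_cancel] at *
  field_simp
  linear_combination (-(a + b + 1) * (a + b) * p * (1 - p) * G) * e2

theorem natCast_add_ne_zero_of_neg_one_lt_re {a : ℂ} (ha : -1 < a.re) (n : ℕ) :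
    a + 1 + n ≠ 0 := by
  intro h
  have := congrArg re h
  simp at this
  have hn : (0 : ℝ) ≤ n := n.cast_nonneg
  linarith

/-! ### The differential equation of the power series. -/

theorem regularizedHGFunCoeff_one_succ {a : ℂ} (ha : -1 < a.re) (β : ℂ) (n : ℕ) :
    (a + 1 + n) * regularizedHGFunCoeff {1, β} {a + 1} (n + 1) =
      (β + n) * regularizedHGFunCoeff {1, β} {a + 1} n := by
  have h0 := natCast_add_ne_zero_of_neg_one_lt_re ha n
  have h1 : (n : ℂ) + 1 ≠ 0 := by exact_mod_cast n.succ_ne_zero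
  have h2 : 1 + (n : ℂ) ≠ 0 := by rwa [add_comm]
  rw [regularizedHGFunCoeff_add_one]
  · simp
    field_simp
    ring
  · intro k hk h
    simp at hk
    rw [hk] at h
    exact h0 (by rw [h]; ring)

theorem regularizedHGFun_eq_tsum (a b : Multiset ℂ) (z : ℂ) :
    regularizedHGFun a b z = ∑' n, regularizedHGFunCoeff a b n * z ^ n := by
  have := FormalMultilinearSeries.ofScalars_sum_eq (regularizedHGFunCoeff a b) z
  simpa only [smul_eq_mul, regularizedHGFun, regularizedHGFunSeries,
    FormalMultilinearSeries.ofScalarsSum] using this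

theorem summable_regularizedHGFunCoeff {a b : Multiset ℂ} (h : a.card = b.card + 1) {r : ℝ}
    (hr : 0 ≤ r) (hr1 : r < 1) : Summable fun n => ‖regularizedHGFunCoeff a b n‖ * r ^ n := by
  lift r to NNReal using hr
  have := (regularizedHGFunSeries a b).summable_norm_mul_pow (r := r)
    (lt_of_lt_of_le (by exact_mod_cast hr1) (radius_regularizedHGFunSeries_ge_one h))
  simpa [regularizedHGFunSeries, FormalMultilinearSeries.ofScalars_norm] using this

theorem analyticAt_regularizedHGFun {a b : Multiset ℂ} (h : a.card = b.card + 1) :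
    AnalyticAt ℂ (regularizedHGFun a b) 0 :=
  ((regularizedHGFunSeries a b).hasFPowerSeriesOnBall
    (lt_of_lt_of_le zero_lt_one (radius_regularizedHGFunSeries_ge_one h))).analyticAt

theorem regularizedHGFun_zero_arg (a b : Multiset ℂ) :
    regularizedHGFun a b 0 = regularizedHGFunCoeff a b 0 := by
  rw [regularizedHGFun_eq_tsum, tsum_eq_single 0]
  · simp
  · intro n hn
    simp [hn]

/-- By the recurrence, `z f' + a f` without its constant term `a c₀` equals `z (z f' + (1 - b) f)`.
-/
theorem tsum_pow_ode {a b : ℂ} {c : ℕ → ℂ} {r : ℝ}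
    (hs : Summable fun n => ‖c n‖ * r ^ n)
    (hrec : ∀ n : ℕ, (a + 1 + n) * c (n + 1) = (1 - b + n) * c n) {z : ℂ}
    (hz : z ∈ Metric.ball (0 : ℂ) r) :
    z * (1 - z) * deriv (fun w => ∑' n, c n * w ^ n) z +
      (a + z * (b - 1)) * (∑' n, c n * z ^ n) = a * c 0 := by
  have hbound : ∀ (n : ℕ) (w : ℂ), w ∈ Metric.ball (0 : ℂ) r → ‖c n * w ^ n‖ ≤ ‖c n‖ * r ^ n := by
    intro n w hw
    rw [norm_mul, norm_pow]
    have : ‖w‖ ≤ r := (mem_ball_zero_iff.1 hw).le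
    gcongr
  have hcongr : ∀ {u v : ℕ → ℂ} {s : ℂ}, (∀ n, u n = v n) → HasSum v s → HasSum u s := by
    intro u v s h hv
    rwa [funext h]
  have h1 : HasSum (fun n => c n * z ^ n) (∑' n, c n * z ^ n) :=
    (Summable.of_norm_bounded hs fun n => hbound n z hz).hasSum
  have h2 : HasSum (fun n : ℕ => c n * (n * z ^ (n - 1)))
      (deriv (fun w => ∑' n, c n * w ^ n) z) := by
    have := hasSum_deriv_of_summable_norm hs (F := fun n w => c n * w ^ n)
      (fun n => by fun_prop) Metric.isOpen_ball hbound hz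
    simpa using this
  generalize deriv (fun w => ∑' n, c n * w ^ n) z = f' at *
  generalize ∑' n, c n * z ^ n = f at *
  have h3 : HasSum (fun n : ℕ => (a + n) * c n * z ^ n) (z * f' + a * f) := by
    refine hcongr (fun n => ?_) ((h2.mul_left z).add (h1.mul_left a))
    rcases n with _ | n
    · simp
    · rw [Nat.add_sub_cancel, pow_succ]
      ring
  have h4 : HasSum (fun n : ℕ => (a + (n + 1 : ℕ)) * c (n + 1) * z ^ (n + 1))
      (z * (z * f' + (1 - b) * f)) := by
    refine hcongr (fun n => ?_) (((h2.mul_left z).add (h1.mul_left (1 - b))).mul_left z)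
    have := hrec n
    push_cast
    rw [show a + (n + 1 : ℂ) = a + 1 + n by ring, this]
    rcases n with _ | n
    · simp
      ring
    · rw [Nat.add_sub_cancel, pow_succ, pow_succ]
      ring
  have h6 := h3.unique ((hasSum_nat_add_iff (f := fun n : ℕ => (a + n) * c n * z ^ n) 1).1 h4)
  simp at h6
  linear_combination h6

theorem regularizedHGFun_one_ode {a : ℂ} (ha : -1 < a.re) (b : ℂ) {z : ℂ}
    (hz : z ∈ Metric.ball (0 : ℂ) (1 / 2)) :
    z * (1 - z) * deriv (regularizedHGFun {1, 1 - b} {a + 1}) z +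
      (a + z * (b - 1)) * regularizedHGFun {1, 1 - b} {a + 1} z = a * (Gamma (a + 1))⁻¹ := by
  have hs := summable_regularizedHGFunCoeff (a := {1, 1 - b}) (b := {a + 1}) (by simp)
    (r := 1 / 2) (by norm_num) (by norm_num)
  have key := tsum_pow_ode hs (regularizedHGFunCoeff_one_succ ha (1 - b)) hz
  have h0 : regularizedHGFunCoeff {1, 1 - b} {a + 1} 0 = (Gamma (a + 1))⁻¹ := by
    simp [regularizedHGFunCoeff]
  rw [h0, ← regularizedHGFun_eq_tsum] at key
  rw [← key]
  congr 3
  exact funext fun w => regularizedHGFun_eq_tsum _ _ w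

/-- At the regular singular point `0`, an analytic solution of the homogeneous equation that
vanishes at `0` vanishes identically. -/
theorem eventuallyEq_zero_of_ode {a b : ℂ} (ha : -1 < a.re) {E : ℂ → ℂ} (hE : AnalyticAt ℂ E 0)
    (h0 : E 0 = 0)
    (hode : ∀ᶠ z in 𝓝 0, z * (1 - z) * deriv E z + (a + z * (b - 1)) * E z = 0) :
    E =ᶠ[𝓝 0] 0 := by
  by_contra hne
  obtain ⟨n, h, hh, hh0, hEh⟩ := hE.exists_eventuallyEq_pow_smul_nonzero_iff.2 hne
  have hn : n ≠ 0 := by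
    rintro rfl
    have := hEh.self_of_nhds
    simp [h0] at this
    exact hh0 this.symm
  obtain ⟨m, rfl⟩ := Nat.exists_eq_succ_of_ne_zero hn
  have hder : ∀ᶠ z in 𝓝 (0 : ℂ), deriv E z = (m + 1) * z ^ m * h z + z ^ (m + 1) * deriv h z := by
    filter_upwards [hEh.eventually_nhds, hh.eventually_analyticAt] with z hz hhz
    rw [Filter.EventuallyEq.deriv_eq (show E =ᶠ[𝓝 z] fun w => w ^ (m + 1) * h w by
      filter_upwards [hz] with w hw
      simpa using hw)]
    have := ((hasDerivAt_pow (m + 1) z).mul hhz.differentiableAt.hasDerivAt).deriv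
    rw [show (fun w => w ^ (m + 1) * h w) = (fun w => w ^ (m + 1)) * h from rfl, this]
    simp
  have hcont : ContinuousAt (fun z => (1 - z) * ((m + 1) * h z + z * deriv h z) +
      (a + z * (b - 1)) * h z) 0 := by
    have := hh.continuousAt
    have := hh.deriv.continuousAt
    fun_prop
  have hzero : ∀ᶠ z in 𝓝[≠] (0 : ℂ), (1 - z) * ((m + 1) * h z + z * deriv h z) +
      (a + z * (b - 1)) * h z = 0 := by
    filter_upwards [nhdsWithin_le_nhds hder, nhdsWithin_le_nhds hode, nhdsWithin_le_nhds hEh,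
      self_mem_nhdsWithin] with z h1 h2 h3 h4
    have h4' : z ^ (m + 1) ≠ 0 := pow_ne_zero _ h4
    apply mul_left_cancel₀ h4'
    rw [h1, h3] at h2
    simp only [sub_zero, smul_eq_mul, Nat.succ_eq_add_one] at h2
    linear_combination h2
  -- With `E = z^(m + 1) h`, the equation divided by `z^(m + 1)` tends to `(a + 1 + m) h(0) = 0` as
  -- `z → 0`; the first factor is nonzero because `Re a > -1`.
  have hlim := tendsto_nhds_unique (hcont.tendsto.mono_left nhdsWithin_le_nhds)
    (tendsto_const_nhds.congr' (hzero.mono fun z hz => hz.symm))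
  have := natCast_add_ne_zero_of_neg_one_lt_re ha m
  simp at hlim
  apply mul_ne_zero this hh0
  linear_combination hlim

/-! ### Identification of the continued series with the closed form. -/

theorem analyticOnNhd_binomialTail {a : ℂ} (ha : -1 < a.re) (b : ℂ) :
    AnalyticOnNhd ℂ (binomialTail a b) {z | 1 - z ∈ slitPlane} := by
  refine DifferentiableOn.analyticOnNhd (fun z hz => ?_)
    (isOpen_slitPlane.preimage (by fun_prop))
  obtain ⟨g', hg', -⟩ := binomialTail_hasDerivAt (b := b) ha hz
  exact hg'.differentiableAt.differentiableWithinAt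

theorem inv_Gamma_eq (b : ℂ) : b * (Gamma (b + 1))⁻¹ = (Gamma b)⁻¹ :=
  (one_div_Gamma_eq_self_mul_one_div_Gamma_add_one b).symm

/-- Both sides solve the same equation and are analytic at `0`. Their values there are compared as
well, because for `a = 0` the homogeneous equation has a nonzero analytic solution. -/
theorem binomialTail_eventuallyEq {a : ℂ} (ha : -1 < a.re) (b : ℂ) :
    binomialTail a b =ᶠ[𝓝 0]
      fun z => (Gamma b)⁻¹ * regularizedHGFun {1, 1 - b} {a + 1} z := by
  have hU : ∀ᶠ z : ℂ in 𝓝 0, 1 - z ∈ slitPlane :=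
    (isOpen_slitPlane.preimage (by fun_prop : Continuous fun z : ℂ => 1 - z)).mem_nhds
      (by simp)
  have hf : AnalyticAt ℂ (regularizedHGFun {1, 1 - b} {a + 1}) 0 :=
    analyticAt_regularizedHGFun (by simp)
  have hg : AnalyticAt ℂ (binomialTail a b) 0 :=
    analyticOnNhd_binomialTail ha b 0 hU.self_of_nhds
  have key := eventuallyEq_zero_of_ode (b := b) ha
    (E := fun z => binomialTail a b z - (Gamma b)⁻¹ * regularizedHGFun {1, 1 - b} {a + 1} z)
    (hg.sub (analyticAt_const.mul hf)) ?_ ?_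
  · filter_upwards [key] with z hz
    exact sub_eq_zero.1 hz
  · rw [regularizedHGFun_zero_arg]
    simp [binomialTail, regularizedHGFunCoeff, ← inv_Gamma_eq b]
    ring
  · filter_upwards [hU, Metric.ball_mem_nhds (0 : ℂ) one_half_pos, hf.eventually_analyticAt]
      with z hz hz' hfz
    obtain ⟨g', hg', hode⟩ := binomialTail_hasDerivAt (b := b) ha hz
    have hode' := regularizedHGFun_one_ode ha b hz'
    have := (hg'.sub (hfz.differentiableAt.hasDerivAt.const_mul (Gamma b)⁻¹)).deriv
    rw [show (fun z => binomialTail a b z -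
      (Gamma b)⁻¹ * regularizedHGFun {1, 1 - b} {a + 1} z) = binomialTail a b - fun z =>
      (Gamma b)⁻¹ * regularizedHGFun {1, 1 - b} {a + 1} z from rfl, this]
    rw [← inv_Gamma_eq b]
    linear_combination hode - b * (Gamma (b + 1))⁻¹ * hode'

/-- The cut plane is star-shaped about `0`, so the closed form is an admissible continuation along
the segment. -/
theorem binomialTail_eq {a : ℂ} (ha : -1 < a.re) (b : ℂ) {z : ℂ} (hz : 1 - z ∈ slitPlane) :
    (Gamma b)⁻¹ * segmentContinuation (regularizedHGFun {1, 1 - b} {a + 1}) z =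
      binomialTail a b z := by
  have hseg : segment ℝ 0 z ⊆ {z | 1 - z ∈ slitPlane} := by
    rintro w ⟨s, t, hs, ht, hst, rfl⟩
    have := one_sub_mul_mem_slitPlane hz (v := t) ⟨ht, by linarith⟩
    simpa [mul_comm] using this
  have hA := (analyticOnNhd_binomialTail ha b).mono hseg
  have hE := binomialTail_eventuallyEq ha b
  -- `Gamma b = 0` means that `b` is a pole of `Γ`; then `(Gamma b)⁻¹ = 0` is the true value of `1 /
  -- Γ` and both sides vanish.
  by_cases h : Gamma b = 0
  · simp only [h, inv_zero, zero_mul] at hE ⊢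
    rw [← segmentContinuation_eq hA hE,
      segmentContinuation_eq (g := fun _ => 0) analyticOnNhd_const .rfl]
  · rw [segmentContinuation_eq (g := fun w => Gamma b * binomialTail a b w)
      (analyticOnNhd_const.mul hA)]
    · field_simp
    · filter_upwards [hE] with w hw
      rw [hw]
      field_simp

theorem segmentContinuation_const_mul {c : ℂ} (hc : c ≠ 0) (f : ℂ → ℂ) (z : ℂ) :
    segmentContinuation (fun w => c * f w) z = c * segmentContinuation f z := by
  by_cases h : ∃ g : ℂ → ℂ, AnalyticOnNhd ℂ g (segment ℝ 0 z) ∧ g =ᶠ[𝓝 0] f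
  · obtain ⟨g, hg, hgf⟩ := h
    rw [segmentContinuation_eq hg hgf,
      segmentContinuation_eq (g := fun w => c * g w) (analyticOnNhd_const.mul hg)]
    filter_upwards [hgf] with w hw
    rw [hw]
  · have h' : ¬ ∃ g : ℂ → ℂ, AnalyticOnNhd ℂ g (segment ℝ 0 z) ∧ g =ᶠ[𝓝 0] fun w => c * f w := by
      rintro ⟨g, hg, hgf⟩
      refine h ⟨fun w => c⁻¹ * g w, analyticOnNhd_const.mul hg, ?_⟩
      filter_upwards [hgf] with w hw
      rw [hw, inv_mul_cancel_left₀ hc]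
    rw [segmentContinuation, dif_neg h', segmentContinuation, dif_neg h, mul_zero]

theorem regularizedHGFunCoeff_cancel {d : ℂ} (hd : ∀ k : ℕ, d ≠ -k) (u v w : ℂ) (n : ℕ) :
    regularizedHGFunCoeff {u, d, v} {d, w} n = (Gamma d)⁻¹ * regularizedHGFunCoeff {u, v} {w} n := by
  have h := Gamma_add_nat_div_Gamma_eq (n := n) d hd
  have h0 : Gamma d ≠ 0 := Gamma_ne_zero hd
  have h1 : Gamma (d + n) ≠ 0 := Gamma_ne_zero fun m hm => hd (m + n) (by
    push_cast
    linear_combination hm)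
  simp only [regularizedHGFunCoeff, Multiset.insert_eq_cons, Multiset.map_cons,
    Multiset.map_singleton, Multiset.prod_cons, Multiset.prod_singleton, ← h]
  field_simp

/-- Reduces the `₃F₂` with common parameter `1 + ν` to a `₂F₁`; the regularization leaves the factor
`1 / Γ(d)`. -/
theorem regularizedHGFun_cancel {d : ℂ} (hd : ∀ k : ℕ, d ≠ -k) (u v w : ℂ) :
    regularizedHGFun {u, d, v} {d, w} = fun z => (Gamma d)⁻¹ * regularizedHGFun {u, v} {w} z := by
  funext z
  simp only [regularizedHGFun_eq_tsum, regularizedHGFunCoeff_cancel hd, mul_assoc, tsum_mul_left]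

/-! ### The estimator in closed form. -/

/-- One of the two summands of the estimator, in closed form. -/
noncomputable def estimatorTerm (α₁ α₂ : ℝ) (s : ℂ) (y₁ y₂ : ℝ) : ℂ :=
  Gamma α₁ * Gamma α₂ / (α₁ * y₁) * (((α₂ * y₂ / (α₁ * y₁) : ℝ) : ℂ) ^ s *
    binomialTail (α₂ - 1 + s) (α₁ - 1 - s) (-((α₂ * y₂ / (α₁ * y₁) : ℝ) : ℂ)))

theorem one_sub_neg_ofReal_mem_slitPlane {t : ℝ} (ht : 0 ≤ t) : 1 - (-(t : ℂ)) ∈ slitPlane := by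
  left
  simp
  linarith

theorem estimatorFormula_eq {α₁ α₂ : ℝ} (h₁ : 0 < α₁) (h₁' : α₁ ≠ 1) (h₂ : 0 < α₂) {ν : ℂ}
    (hν : -α₂ < ν.re) {y₁ y₂ : ℝ} (hy₁ : 0 < y₁) (hy₂ : 0 < y₂) :
    estimatorFormula α₁ α₂ ν y₁ y₂ =
      estimatorTerm α₁ α₂ 0 y₁ y₂ - estimatorTerm α₁ α₂ ν y₁ y₂ := by
  have ht : 0 < α₂ * y₂ / (α₁ * y₁) := by positivity
  rw [estimatorFormula, estimatorTerm, estimatorTerm]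
  rw [show (-(((α₂ : ℂ) * (y₂ : ℂ)) / ((α₁ : ℂ) * (y₁ : ℂ)))) =
    -((α₂ * y₂ / (α₁ * y₁) : ℝ) : ℂ) by push_cast; ring]
  generalize α₂ * y₂ / (α₁ * y₁) = t at *
  have hz := one_sub_neg_ofReal_mem_slitPlane ht.le
  have hα : Gamma ((α₁ : ℂ) - 1) ≠ 0 := by
    refine Gamma_ne_zero fun m hm => ?_
    have := congrArg re hm
    simp at this
    rcases m with _ | m
    · simp at this
      exact h₁' (by linarith)
    · push_cast at this
      have : (0 : ℝ) ≤ m := m.cast_nonneg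
      linarith
  have hΓ : Gamma (α₁ : ℂ) = (α₁ - 1) * Gamma ((α₁ : ℂ) - 1) := by
    have : (α₁ : ℂ) - 1 ≠ 0 := fun h => h₁' (by exact_mod_cast sub_eq_zero.1 h)
    rw [← Gamma_add_one _ this, sub_add_cancel]
  have hα₂ : Gamma (α₂ : ℂ) ≠ 0 := Gamma_ne_zero_of_re_pos (by simpa using h₂)
  have hα₂ν : Gamma ((α₂ : ℂ) + ν) ≠ 0 := Gamma_ne_zero_of_re_pos (by simp; linarith)
  have e0 := binomialTail_eq (a := (α₂ : ℂ) - 1 + 0) (by simp; linarith) ((α₁ : ℂ) - 1 - 0) hz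
  have e1 := binomialTail_eq (a := (α₂ : ℂ) - 1 + ν) (by simp; linarith) ((α₁ : ℂ) - 1 - ν) hz
  rw [← e0, ← e1]
  have i1 : 1 - ((α₁ : ℂ) - 1 - 0) = 2 - α₁ := by ring
  have i2 : (α₂ : ℂ) - 1 + 0 + 1 = α₂ := by ring
  have i3 : 1 - ((α₁ : ℂ) - 1 - ν) = 2 - α₁ + ν := by ring
  have i4 : (α₂ : ℂ) - 1 + ν + 1 = α₂ + ν := by ring
  have i5 : 1 - (2 - (α₁ : ℂ)) = α₁ - 1 := by ring
  have i6 : (α₁ : ℂ) - 1 + -ν = α₁ - 1 - ν := by ring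
  rw [i1, i2, i3, i4, hΓ, sineModHypergeometric, sub_zero, cpow_zero]
  -- Since `α = 1` here, the second case says exactly that `1 + ν` is not a pole of `Γ`, so the
  -- common parameter may be cancelled.
  split_ifs with hcase
  · simp only [genHypergeometric, pochhammerSymbol, i5, i6, Multiset.map_singleton,
      Multiset.prod_singleton, neg_neg]
    field_simp
  · have hν1 : ∀ k : ℕ, 1 + ν ≠ -k := fun k hk => hcase ⟨rfl, k, by linear_combination hk⟩
    have hΓν : Gamma (1 + ν) ≠ 0 := Gamma_ne_zero hν1
    simp only [genHypergeometric, pochhammerSymbol, i5, i6, Multiset.map_singleton,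
      Multiset.prod_singleton, neg_neg, Multiset.insert_eq_cons, Multiset.map_cons,
      Multiset.prod_cons, Gamma_one, div_one]
    simp only [← Multiset.insert_eq_cons, regularizedHGFun_cancel hν1]
    rw [segmentContinuation_const_mul (inv_ne_zero hΓν)]
    field_simp

theorem continuousAt_eulerIntegral {a k z : ℂ} (ha : -1 < a.re) (hz : 1 - z ∈ slitPlane) :
    ContinuousAt (fun p : ℂ × ℂ => eulerIntegral a p.1 p.2) (k, z) := by
  have hopen : IsOpen {z : ℂ | 1 - z ∈ slitPlane} :=
    isOpen_slitPlane.preimage (by fun_prop)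
  obtain ⟨ε, hε, hball⟩ := Metric.nhds_basis_closedBall.mem_iff.1 (hopen.mem_nhds hz)
  have hcont : ContinuousOn (fun q : (ℂ × ℂ) × ℝ => (1 - q.1.2 * q.2) ^ (-q.1.1))
      ((Metric.closedBall k 1 ×ˢ Metric.closedBall z ε) ×ˢ Icc 0 1) := by
    refine ContinuousOn.cpow (by fun_prop) (by fun_prop) ?_
    rintro ⟨⟨l, w⟩, v⟩ ⟨⟨-, hw⟩, hv⟩
    exact one_sub_mul_mem_slitPlane (hball hw) hv
  obtain ⟨C, hC⟩ := (((isCompact_closedBall k 1).prod (isCompact_closedBall z ε)).prod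
    isCompact_Icc).exists_bound_of_continuousOn hcont
  have hnhds : Metric.closedBall k 1 ×ˢ Metric.closedBall z ε ∈ 𝓝 (k, z) :=
    prod_mem_nhds (Metric.closedBall_mem_nhds k one_pos) (Metric.closedBall_mem_nhds z hε)
  refine intervalIntegral.continuousAt_of_dominated_interval
    (bound := fun v : ℝ => ‖(v : ℂ) ^ a‖ * C) ?_ ?_ ?_ ?_
  · filter_upwards [hnhds] with p hp
    have := intervalIntegrable_eulerIntegral (k := p.1) ha (hball hp.2)
    rw [intervalIntegrable_iff] at this
    exact this.1
  · filter_upwards [hnhds] with p hp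
    refine ae_of_all _ fun v hv => ?_
    rw [uIoc_of_le zero_le_one] at hv
    rw [norm_mul]
    exact mul_le_mul_of_nonneg_left (hC (p, v) ⟨hp, hv.1.le, hv.2⟩) (norm_nonneg _)
  · exact (intervalIntegral.intervalIntegrable_cpow' ha).norm.mul_const _
  · refine ae_of_all _ fun v hv => ?_
    rw [uIoc_of_le zero_le_one] at hv
    refine continuousAt_const.mul (ContinuousAt.cpow (by fun_prop) (by fun_prop) ?_)
    exact one_sub_mul_mem_slitPlane hz ⟨hv.1.le, hv.2⟩

theorem continuousAt_binomialTail {a b z : ℂ} (ha : -1 < a.re) (hz : 1 - z ∈ slitPlane) :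
    ContinuousAt (fun p : ℂ × ℂ => binomialTail a p.1 p.2) (b, z) := by
  have h0 : (1 - z) ^ 2 ≠ 0 := pow_ne_zero 2 (slitPlane_ne_zero hz)
  have hM : ContinuousAt (fun p : ℂ × ℂ => eulerIntegral a (a + p.1 + 2) p.2) (b, z) :=
    ContinuousAt.comp (g := fun p : ℂ × ℂ => eulerIntegral a p.1 p.2)
      (f := fun p : ℂ × ℂ => (a + p.1 + 2, p.2)) (continuousAt_eulerIntegral ha hz) (by fun_prop)
  have hG : Continuous fun p : ℂ × ℂ => (Gamma (p.1 + 1))⁻¹ :=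
    differentiable_one_div_Gamma.continuous.comp (by fun_prop)
  have hp : ContinuousAt (fun p : ℂ × ℂ => (1 - p.2) ^ (a + p.1 - 1)) (b, z) :=
    ContinuousAt.cpow (by fun_prop) (by fun_prop) hz
  have hq : ContinuousAt (fun p : ℂ × ℂ => (p.1 + a * p.2) / (1 - p.2) ^ 2) (b, z) :=
    ContinuousAt.div (by fun_prop) (by fun_prop) h0
  unfold binomialTail
  exact (hq.sub (ContinuousAt.mul (by fun_prop) (hp.mul (continuousAt_snd.mul hM)))).mul
    (continuousAt_const.mul hG.continuousAt)

theorem continuousAt_estimatorTerm {α₁ α₂ : ℝ} (h₁ : 0 < α₁) (h₂ : 0 < α₂) {s : ℂ}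
    (hs : -α₂ < s.re) {y₁ y₂ : ℝ} (hy₁ : 0 < y₁) (hy₂ : 0 < y₂) :
    ContinuousAt (fun p : ℝ × ℝ × ℝ => estimatorTerm p.1 α₂ s p.2.1 p.2.2) (α₁, y₁, y₂) := by
  have ht : 0 < α₂ * y₂ / (α₁ * y₁) := by positivity
  have hΓ : ContinuousAt (fun p : ℝ × ℝ × ℝ => Gamma (p.1 : ℂ)) (α₁, y₁, y₂) := by
    refine ContinuousAt.comp (g := Gamma) (f := fun p : ℝ × ℝ × ℝ => (p.1 : ℂ)) ?_ (by fun_prop)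
    refine (differentiableAt_Gamma _ fun m hm => ?_).continuousAt
    have := congrArg re hm
    simp at this
    have hm : (0 : ℝ) ≤ m := m.cast_nonneg
    linarith
  have htc : ContinuousAt (fun p : ℝ × ℝ × ℝ => ((α₂ * p.2.2 / (p.1 * p.2.1) : ℝ) : ℂ))
      (α₁, y₁, y₂) := by
    refine continuous_ofReal.continuousAt.comp (ContinuousAt.div (by fun_prop) (by fun_prop) ?_)
    exact (mul_pos h₁ hy₁).ne'
  have hb : ContinuousAt (fun p : ℝ × ℝ × ℝ => binomialTail (α₂ - 1 + s) (p.1 - 1 - s)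
      (-((α₂ * p.2.2 / (p.1 * p.2.1) : ℝ) : ℂ))) (α₁, y₁, y₂) :=
    ContinuousAt.comp (g := fun p : ℂ × ℂ => binomialTail (α₂ - 1 + s) p.1 p.2)
      (f := fun p : ℝ × ℝ × ℝ => ((p.1 : ℂ) - 1 - s, -((α₂ * p.2.2 / (p.1 * p.2.1) : ℝ) : ℂ)))
      (continuousAt_binomialTail (by simp; linarith) (one_sub_neg_ofReal_mem_slitPlane ht.le))
      (ContinuousAt.prodMk (by fun_prop) htc.neg)
  unfold estimatorTerm
  refine ContinuousAt.mul (ContinuousAt.div (hΓ.mul continuousAt_const) (by fun_prop) ?_)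
    ((htc.cpow continuousAt_const ?_).mul hb)
  · exact mul_ne_zero (ofReal_ne_zero.2 h₁.ne') (ofReal_ne_zero.2 hy₁.ne')
  · exact ofReal_mem_slitPlane.2 ht

theorem estimatorT_eq {α₁ α₂ : ℝ} (h₁ : 0 < α₁) (h₂ : 0 < α₂) {ν : ℂ}
    (hν : -α₂ < ν.re) {y₁ y₂ : ℝ} (hy₁ : 0 < y₁) (hy₂ : 0 < y₂) :
    estimatorT α₁ α₂ ν y₁ y₂ = estimatorTerm α₁ α₂ 0 y₁ y₂ - estimatorTerm α₁ α₂ ν y₁ y₂ := by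
  rw [estimatorT]
  split_ifs with h
  · subst h
    -- The closed form is continuous in the shape parameter through `1`, so the limit is its value
    -- at `1`.
    have hc : ∀ {s : ℂ}, -α₂ < s.re → ContinuousAt (fun a => estimatorTerm a α₂ s y₁ y₂) 1 :=
      fun hs => ContinuousAt.comp (g := fun p : ℝ × ℝ × ℝ => estimatorTerm p.1 α₂ _ p.2.1 p.2.2)
        (f := fun a : ℝ => (a, y₁, y₂)) (continuousAt_estimatorTerm h₁ h₂ hs hy₁ hy₂)
        (by fun_prop)
    refine Tendsto.limUnder_eq ?_
    refine Tendsto.congr' ?_ ((((hc (s := 0) (by simpa using h₂)).sub (hc hν)).tendsto).mono_left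
      nhdsWithin_le_nhds)
    filter_upwards [self_mem_nhdsWithin, nhdsWithin_le_nhds (lt_mem_nhds one_pos)] with a ha ha'
    exact (estimatorFormula_eq ha' ha h₂ hν hy₁ hy₂).symm
  · exact estimatorFormula_eq h₁ h h₂ hν hy₁ hy₂

/-! ### Fubini arguments and the Beta integral. -/

/-- Change of variables `(x, t) ↦ (x, k x t)` on the open quadrant. -/
theorem integrable_and_integral_prod_of_comp_mul {k : ℝ} (hk : 0 < k) {F : ℝ × ℝ → ℂ}
    (hF : ContinuousOn F (Ioi 0 ×ˢ Ioi 0))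
    (h : Integrable (fun p : ℝ × ℝ => (k * p.1) • F (p.1, k * p.1 * p.2))
      ((volume.restrict (Ioi 0)).prod (volume.restrict (Ioi 0)))) :
    Integrable F ((volume.restrict (Ioi 0)).prod (volume.restrict (Ioi 0))) ∧
      ∫ p, F p ∂((volume.restrict (Ioi 0)).prod (volume.restrict (Ioi 0))) =
        ∫ p : ℝ × ℝ, (k * p.1) • F (p.1, k * p.1 * p.2)
          ∂((volume.restrict (Ioi 0)).prod (volume.restrict (Ioi 0))) := by
  have hint : Integrable F ((volume.restrict (Ioi 0)).prod (volume.restrict (Ioi 0))) := by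
    have hm : AEStronglyMeasurable F
        ((volume.restrict (Ioi 0)).prod (volume.restrict (Ioi 0))) := by
      rw [Measure.prod_restrict]
      exact hF.aestronglyMeasurable (measurableSet_Ioi.prod measurableSet_Ioi)
    refine (integrable_prod_iff hm).2 ⟨?_, ?_⟩
    · filter_upwards [h.prod_right_ae, ae_restrict_mem measurableSet_Ioi] with x hx hx0
      have hkx : 0 < k * x := mul_pos hk hx0
      have := (integrableOn_Ioi_comp_mul_left_iff (fun y => F (x, y)) 0 hkx).1
        ((integrable_smul_iff hkx.ne' _).1 hx)
      simpa [IntegrableOn] using this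
    · refine h.integral_norm_prod_left.congr ?_
      filter_upwards [ae_restrict_mem measurableSet_Ioi] with x hx0
      have hkx : 0 < k * x := mul_pos hk hx0
      have := integral_comp_mul_left_Ioi (fun y => ‖F (x, y)‖) 0 hkx
      simp only [norm_smul, Real.norm_of_nonneg hkx.le]
      rw [integral_const_mul, this, mul_zero, smul_eq_mul, mul_inv_cancel_left₀ hkx.ne']
  refine ⟨hint, ?_⟩
  rw [integral_prod _ hint, integral_prod _ h]
  refine integral_congr_ae ?_
  filter_upwards [ae_restrict_mem measurableSet_Ioi] with x hx0
  have hkx : 0 < k * x := mul_pos hk hx0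
  have := integral_comp_mul_left_Ioi (fun y => F (x, y)) 0 hkx
  rw [integral_smul, this, mul_zero, smul_inv_smul₀ hkx.ne']

/-- For fixed `t` the `x`-integral is a Gamma integral. The kernel is positive, so the same
evaluation computes the integral of the norm and gives integrability on the product. -/
theorem integrable_prod_gamma_kernel {m p q : ℝ} (hm : 0 < m) (hp : 0 < p) (hq : 0 < q)
    {w : ℝ → ℂ} (hw : ContinuousOn w (Ioi 0))
    (h : IntegrableOn (fun t => (((p + q * t) ^ (-m) : ℝ) : ℂ) * w t) (Ioi 0)) :
    Integrable (fun x : ℝ × ℝ =>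
        ((x.1 ^ (m - 1) * Real.exp (-((p + q * x.2) * x.1)) : ℝ) : ℂ) * w x.2)
      ((volume.restrict (Ioi 0)).prod (volume.restrict (Ioi 0))) ∧
    ∫ x : ℝ × ℝ, ((x.1 ^ (m - 1) * Real.exp (-((p + q * x.2) * x.1)) : ℝ) : ℂ) * w x.2
        ∂((volume.restrict (Ioi 0)).prod (volume.restrict (Ioi 0))) =
      Real.Gamma m * ∫ t in Ioi (0 : ℝ), (((p + q * t) ^ (-m) : ℝ) : ℂ) * w t := by
  have hr : ∀ t ∈ Ioi (0 : ℝ), 0 < p + q * t := fun t ht => by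
    have : 0 < t := ht
    positivity
  have hval : ∀ t ∈ Ioi (0 : ℝ), ∫ x in Ioi (0 : ℝ), x ^ (m - 1) * Real.exp (-((p + q * t) * x)) =
      (p + q * t) ^ (-m) * Real.Gamma m := fun t ht => by
    rw [Real.integral_rpow_mul_exp_neg_mul_Ioi hm (hr t ht), one_div,
      Real.inv_rpow (hr t ht).le, Real.rpow_neg (hr t ht).le]
  have hint : ∀ t ∈ Ioi (0 : ℝ), IntegrableOn
      (fun x : ℝ => x ^ (m - 1) * Real.exp (-((p + q * t) * x))) (Ioi 0) := fun t ht => by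
    refine Integrable.of_integral_ne_zero ?_
    rw [hval t ht]
    exact (mul_pos (Real.rpow_pos_of_pos (hr t ht) _) (Real.Gamma_pos_of_pos hm)).ne'
  have hInt : Integrable (fun x : ℝ × ℝ =>
        ((x.1 ^ (m - 1) * Real.exp (-((p + q * x.2) * x.1)) : ℝ) : ℂ) * w x.2)
      ((volume.restrict (Ioi 0)).prod (volume.restrict (Ioi 0))) := by
    have hmeas : AEStronglyMeasurable (fun x : ℝ × ℝ =>
        ((x.1 ^ (m - 1) * Real.exp (-((p + q * x.2) * x.1)) : ℝ) : ℂ) * w x.2)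
        ((volume.restrict (Ioi 0)).prod (volume.restrict (Ioi 0))) := by
      rw [Measure.prod_restrict]
      refine ContinuousOn.aestronglyMeasurable ?_ (measurableSet_Ioi.prod measurableSet_Ioi)
      refine ContinuousOn.mul (continuous_ofReal.comp_continuousOn (ContinuousOn.mul ?_ ?_))
        (hw.comp continuousOn_snd fun x hx => hx.2)
      · exact continuousOn_fst.rpow_const fun x hx => Or.inl (ne_of_gt hx.1)
      · fun_prop
    refine (integrable_prod_iff' hmeas).2 ⟨?_, ?_⟩
    · filter_upwards [ae_restrict_mem measurableSet_Ioi] with t ht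
      exact (hint t ht).ofReal.mul_const _
    · refine (h.norm.const_mul (Real.Gamma m)).congr ?_
      filter_upwards [ae_restrict_mem measurableSet_Ioi] with t ht
      simp only [norm_mul]
      rw [integral_mul_const, norm_real,
        Real.norm_of_nonneg (Real.rpow_pos_of_pos (hr t ht) _).le]
      have : ∫ x in Ioi (0 : ℝ), ‖((x ^ (m - 1) * Real.exp (-((p + q * t) * x)) : ℝ) : ℂ)‖ =
          (p + q * t) ^ (-m) * Real.Gamma m := by
        rw [← hval t ht]
        refine setIntegral_congr_fun measurableSet_Ioi fun x hx => ?_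
        have hx0 : 0 < x := hx
        simp only [norm_real]
        rw [Real.norm_of_nonneg (by positivity)]
      rw [this]
      ring
  refine ⟨hInt, ?_⟩
  rw [integral_prod_symm _ hInt, ← integral_const_mul]
  refine integral_congr_ae ?_
  filter_upwards [ae_restrict_mem measurableSet_Ioi] with t ht
  rw [integral_mul_const, integral_complex_ofReal, hval t ht]
  push_cast
  ring

theorem integrableOn_Ioi_of_norm_le {f : ℝ → ℂ} (hf : ContinuousOn f (Ioi 0)) {σ τ C K : ℝ}
    (hσ : -1 < σ) (hτ : τ < -1) (h0 : ∀ t ∈ Ioc (0 : ℝ) 1, ‖f t‖ ≤ C * t ^ σ)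
    (h1 : ∀ t ∈ Ioi (1 : ℝ), ‖f t‖ ≤ K * t ^ τ) : IntegrableOn f (Ioi 0) := by
  rw [← Ioc_union_Ioi_eq_Ioi zero_le_one]
  refine IntegrableOn.union ?_ ?_
  · have hi : IntegrableOn (fun t : ℝ => C * t ^ σ) (Ioc 0 1) :=
      ((intervalIntegrable_iff_integrableOn_Ioc_of_le zero_le_one).1
        (intervalIntegral.intervalIntegrable_rpow' hσ)).const_mul C
    refine Integrable.mono' hi ((hf.mono Ioc_subset_Ioi_self).aestronglyMeasurable
      measurableSet_Ioc) ?_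
    filter_upwards [ae_restrict_mem measurableSet_Ioc] with t ht using h0 t ht
  · refine Integrable.mono' ((integrableOn_Ioi_rpow_of_lt hτ one_pos).const_mul K)
      ((hf.mono (Ioi_subset_Ioi zero_le_one)).aestronglyMeasurable measurableSet_Ioi) ?_
    filter_upwards [ae_restrict_mem measurableSet_Ioi] with t ht using h1 t ht

theorem continuousOn_ofReal_cpow_Ioi (a : ℂ) : ContinuousOn (fun t : ℝ => (t : ℂ) ^ a) (Ioi 0) :=
  continuous_ofReal.continuousOn.cpow continuousOn_const fun _ ht => ofReal_mem_slitPlane.2 ht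

theorem continuousOn_add_rpow_Ioi {ζ : ℝ} (hζ : 0 < ζ) (m : ℝ) :
    ContinuousOn (fun t : ℝ => (((ζ + t) ^ m : ℝ) : ℂ)) (Ici 0) := by
  refine continuous_ofReal.comp_continuousOn (ContinuousOn.rpow_const (by fun_prop) fun t ht => ?_)
  have : 0 ≤ t := ht
  exact Or.inl (by positivity)

theorem integrableOn_betaPrime {a : ℂ} (ha : -1 < a.re) {m ζ : ℝ} (hm : a.re + 1 < m)
    (hζ : 0 < ζ) :
    IntegrableOn (fun t : ℝ => (((ζ + t) ^ (-m) : ℝ) : ℂ) * (t : ℂ) ^ a) (Ioi 0) := by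
  have hm0 : -m ≤ 0 := by linarith
  refine integrableOn_Ioi_of_norm_le (C := ζ ^ (-m)) (K := 1) (σ := a.re) (τ := a.re - m)
    (((continuousOn_add_rpow_Ioi hζ _).mono Ioi_subset_Ici_self).mul
      (continuousOn_ofReal_cpow_Ioi a)) ha (by linarith) ?_ ?_
  · intro t ht
    have ht0 : 0 < t := ht.1
    rw [norm_mul, norm_real, norm_cpow_eq_rpow_re_of_pos ht0, Real.norm_of_nonneg (by positivity)]
    exact mul_le_mul_of_nonneg_right (Real.rpow_le_rpow_of_nonpos hζ (by linarith) hm0)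
      (by positivity)
  · intro t ht
    have ht0 : 0 < t := zero_lt_one.trans ht
    rw [norm_mul, norm_real, norm_cpow_eq_rpow_re_of_pos ht0, Real.norm_of_nonneg (by positivity),
      one_mul, sub_eq_neg_add, Real.rpow_add ht0]
    exact mul_le_mul_of_nonneg_right (Real.rpow_le_rpow_of_nonpos ht0 (by linarith) hm0)
      (by positivity)

/-- The Beta integral over the half-line. -/
theorem integral_betaPrime {a b : ℂ} (ha : -1 < a.re) (hb : -1 < b.re) {m ζ : ℝ}
    (hm : a + b + 2 = m) (hζ : 0 < ζ) :
    ∫ t in Ioi (0 : ℝ), (((ζ + t) ^ (-m) : ℝ) : ℂ) * (t : ℂ) ^ a =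
      (ζ : ℂ) ^ (-(b + 1)) * (Gamma (a + 1) * Gamma (b + 1)) / Gamma m := by
  have hre : a.re + b.re + 2 = m := by simpa using congrArg re hm
  have hm0 : 0 < m := by linarith
  have hI := integrableOn_betaPrime ha (m := m) (by linarith) hζ
  obtain ⟨k1, k2⟩ := integrable_prod_gamma_kernel hm0 hζ one_pos (continuousOn_ofReal_cpow_Ioi a)
    (by simpa using hI)
  have hG : Gamma (m : ℂ) ≠ 0 := Gamma_ne_zero_of_re_pos (by simpa using hm0)
  -- The product of the Gamma integrals for `Γ(b + 1)` (with rate `ζ`) and `Γ(a + 1)` is a double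
  -- integral; substituting `y = x t` in it produces the kernel of the previous lemma.
  have hcomp : (fun p : ℝ × ℝ => (1 * p.1) • (((p.1 : ℂ) ^ b * cexp (-(ζ * p.1))) *
      (((1 * p.1 * p.2 : ℝ) : ℂ) ^ a * cexp (-((1 : ℝ) * (1 * p.1 * p.2 : ℝ)))))) =ᵐ[
      (volume.restrict (Ioi 0)).prod (volume.restrict (Ioi 0))]
      fun x : ℝ × ℝ => ((x.1 ^ (m - 1) * Real.exp (-((ζ + 1 * x.2) * x.1)) : ℝ) : ℂ) *
        (x.2 : ℂ) ^ a := by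
    rw [Measure.prod_restrict]
    filter_upwards [ae_restrict_mem (measurableSet_Ioi.prod measurableSet_Ioi)] with p hp
    have h1 : 0 < p.1 := hp.1
    have h2 : 0 < p.2 := hp.2
    have h1' : (p.1 : ℂ) ≠ 0 := ofReal_ne_zero.2 h1.ne'
    have e1 : ((p.1 ^ (m - 1) : ℝ) : ℂ) = p.1 * (p.1 : ℂ) ^ b * (p.1 : ℂ) ^ a := by
      rw [ofReal_cpow h1.le, ofReal_sub, ← hm,
        show a + b + 2 - ((1 : ℝ) : ℂ) = 1 + b + a by push_cast; ring, cpow_add _ _ h1',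
        cpow_add _ _ h1', cpow_one]
    rw [ofReal_mul (_ ^ _), e1, one_mul, ofReal_mul, mul_cpow_ofReal_nonneg h1.le h2.le, real_smul,
      show ((Real.exp (-((ζ + 1 * p.2) * p.1)) : ℝ) : ℂ) =
        cexp (-(ζ * p.1)) * cexp (-((1 : ℝ) * (p.1 * p.2))) by
          rw [← Complex.exp_add]; push_cast; ring_nf]
    ring
  have hcont : ContinuousOn (fun p : ℝ × ℝ => ((p.1 : ℂ) ^ b * cexp (-(ζ * p.1))) *
      ((p.2 : ℂ) ^ a * cexp (-((1 : ℝ) * p.2)))) (Ioi 0 ×ˢ Ioi 0) := by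
    refine ContinuousOn.mul (ContinuousOn.mul ?_ (by fun_prop)) (ContinuousOn.mul ?_ (by fun_prop))
    · exact (continuousOn_ofReal_cpow_Ioi b).comp continuousOn_fst fun p hp => hp.1
    · exact (continuousOn_ofReal_cpow_Ioi a).comp continuousOn_snd fun p hp => hp.2
  have k3 := (integrable_and_integral_prod_of_comp_mul one_pos hcont
    (k1.congr hcomp.symm)).2
  rw [integral_congr_ae hcomp, k2,
    integral_prod_mul (fun x : ℝ => (x : ℂ) ^ b * cexp (-(ζ * x)))
      (fun x : ℝ => (x : ℂ) ^ a * cexp (-((1 : ℝ) * x)))] at k3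
  have g1 := integral_cpow_mul_exp_neg_mul_Ioi (a := b + 1) (r := ζ) (by simp; linarith)
    (by simpa using hζ)
  have g2 := integral_cpow_mul_exp_neg_mul_Ioi (a := a + 1) (r := (1 : ℝ)) (by simp; linarith)
    (by simp)
  simp only [add_sub_cancel_right] at g1 g2
  rw [g1, g2, ← Gamma_ofReal] at k3
  rw [eq_div_iff hG]
  have e2 : (1 / (ζ : ℂ)) ^ (b + 1) = (ζ : ℂ) ^ (-(b + 1)) := by
    rw [one_div, inv_cpow _ _ (by rw [arg_ofReal_of_nonneg hζ.le]; exact Real.pi_pos.ne),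
      cpow_neg]
  rw [e2] at k3
  simp only [ofReal_one, div_one, one_cpow, one_mul] at k3
  linear_combination -k3

/-! ### The incomplete Beta integral. -/

/-- The incomplete Beta integral `∫₀ᵗ u ^ a (1 + u) ^ (-k) du`. -/
noncomputable def incompleteBetaPrime (a k : ℂ) (t : ℝ) : ℂ :=
  (t : ℂ) ^ (a + 1) * eulerIntegral a k (-t)

theorem ofReal_one_add_rpow {t : ℝ} (ht : 0 ≤ t) (m : ℝ) :
    (1 - (-(t : ℂ))) ^ (m : ℂ) = (((1 + t) ^ m : ℝ) : ℂ) := by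
  rw [ofReal_cpow (by linarith)]
  push_cast
  ring_nf

theorem hasDerivAt_incompleteBetaPrime {a : ℂ} (ha : -1 < a.re) (m : ℝ) {t : ℝ} (ht : 0 < t) :
    HasDerivAt (incompleteBetaPrime a m) ((((1 + t) ^ (-m) : ℝ) : ℂ) * (t : ℂ) ^ a) t := by
  have hz := one_sub_neg_ofReal_mem_slitPlane ht.le
  have hrec := eulerIntegral_recurrence (k := m) ha hz
  have h1 : HasDerivAt (fun t : ℝ => eulerIntegral a m (-t))
      (m * eulerIntegral (a + 1) (m + 1) (-t) * (-1)) t :=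
    HasDerivAt.comp t (hasDerivAt_eulerIntegral (k := m) ha hz)
      ((hasDerivAt_id t).ofReal_comp.neg)
  have ha1 : a + 1 ≠ 0 := fun h => by
    have := congrArg re h
    simp at this
    linarith
  have h2 : HasDerivAt (fun t : ℝ => (t : ℂ) ^ (a + 1)) ((a + 1) * (t : ℂ) ^ a) t := by
    simpa using hasDerivAt_ofReal_cpow_const ht.ne' ha1
  refine (h2.mul h1).congr_deriv ?_
  rw [← ofReal_one_add_rpow ht.le, ofReal_neg, ← hrec, cpow_add _ _ (ofReal_ne_zero.2 ht.ne'),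
    cpow_one]
  ring

theorem continuousOn_incompleteBetaPrime {a : ℂ} (ha : -1 < a.re) (k : ℂ) :
    ContinuousOn (incompleteBetaPrime a k) (Ici 0) := by
  refine ContinuousOn.mul (continuous_ofReal_cpow_const (by simp; linarith)).continuousOn ?_
  intro t ht
  have := (hasDerivAt_eulerIntegral (k := k) ha
    (one_sub_neg_ofReal_mem_slitPlane ht)).continuousAt
  exact (ContinuousAt.comp (g := eulerIntegral a k) (f := fun t : ℝ => -(t : ℂ)) this
    (by fun_prop)).continuousWithinAt

theorem incompleteBetaPrime_zero {a : ℂ} (ha : -1 < a.re) (k : ℂ) :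
    incompleteBetaPrime a k 0 = 0 := by
  have ha1 : a + 1 ≠ 0 := fun h => by
    have := congrArg re h
    simp at this
    linarith
  simp [incompleteBetaPrime, zero_cpow ha1]

theorem incompleteBetaPrime_eq_integral {a : ℂ} (ha : -1 < a.re) {m : ℝ} (hm : a.re + 1 < m)
    {t : ℝ} (ht : 0 ≤ t) :
    incompleteBetaPrime a m t = ∫ u in (0 : ℝ)..t, (((1 + u) ^ (-m) : ℝ) : ℂ) * (u : ℂ) ^ a := by
  have hi := (integrableOn_betaPrime ha hm one_pos).mono_set (Ioc_subset_Ioi_self : Ioc 0 t ⊆ Ioi 0)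
  rw [intervalIntegral.integral_eq_sub_of_hasDerivAt_of_le ht
    ((continuousOn_incompleteBetaPrime ha m).mono Icc_subset_Ici_self)
    (fun u hu => hasDerivAt_incompleteBetaPrime ha m hu.1)
    ((intervalIntegrable_iff_integrableOn_Ioc_of_le ht).2 hi), incompleteBetaPrime_zero ha, sub_zero]

theorem norm_incompleteBetaPrime_le {a : ℂ} (ha : -1 < a.re) {m : ℝ} (hm : a.re + 1 < m)
    {t : ℝ} (ht : 0 ≤ t) :
    ‖incompleteBetaPrime a m t‖ ≤
      ∫ u in Ioi (0 : ℝ), ‖(((1 + u) ^ (-m) : ℝ) : ℂ) * (u : ℂ) ^ a‖ := by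
  have hi := integrableOn_betaPrime ha hm one_pos
  rw [incompleteBetaPrime_eq_integral ha hm ht, intervalIntegral.integral_of_le ht]
  refine (norm_integral_le_integral_norm _).trans ?_
  exact setIntegral_mono_set hi.norm (ae_of_all _ fun _ => norm_nonneg _)
    (LE.le.eventuallyLE Ioc_subset_Ioi_self)

theorem tendsto_incompleteBetaPrime {a b : ℂ} (ha : -1 < a.re) (hb : -1 < b.re) {m : ℝ}
    (hm : a + b + 2 = m) :
    Tendsto (incompleteBetaPrime a m) atTop
      (𝓝 (Gamma (a + 1) * Gamma (b + 1) / Gamma m)) := by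
  have hre : a.re + b.re + 2 = m := by simpa using congrArg re hm
  have hm' : a.re + 1 < m := by linarith
  have h := intervalIntegral_tendsto_integral_Ioi 0 (integrableOn_betaPrime ha hm' one_pos)
    tendsto_id
  rw [integral_betaPrime ha hb hm one_pos, ofReal_one, one_cpow, one_mul] at h
  refine h.congr' ?_
  filter_upwards [eventually_ge_atTop 0] with t ht
  exact (incompleteBetaPrime_eq_integral ha hm' ht).symm

/-- `t ^ a` times the continued series, in terms of the incomplete Beta integral. -/
theorem cpow_mul_binomialTail {a b : ℂ} {c : ℝ} (hc : a + b + 1 = c) {t : ℝ} (ht : 0 < t) :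
    (t : ℂ) ^ a * binomialTail a b (-t) =
      (((b - a * t) * (((1 + t) ^ 2)⁻¹ : ℝ) * (t : ℂ) ^ a +
        c * (c - 1) * ((1 + t) ^ (c - 2) : ℝ) * incompleteBetaPrime a (c + 1 : ℝ) t)) *
      ((Gamma (a + 1))⁻¹ * (Gamma (b + 1))⁻¹) := by
  have e1 : a + b - 1 = ((c - 2 : ℝ) : ℂ) := by push_cast; linear_combination hc
  have e2 : a + b + 2 = ((c + 1 : ℝ) : ℂ) := by push_cast; linear_combination hc
  have e3 : a + b = c - 1 := by linear_combination hc
  rw [binomialTail, hc, e1, e2, e3, ofReal_one_add_rpow ht.le, incompleteBetaPrime,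
    cpow_add _ _ (ofReal_ne_zero.2 ht.ne'), cpow_one]
  push_cast
  ring

/-! ### Integrability of the transform. -/

theorem rpow_one_add_mul_rpow_le {c ζ t : ℝ} (hc : 0 < c) (hζ : 0 < ζ) (ht : 0 ≤ t) :
    (1 + t) ^ (c - 2) * (ζ + t) ^ (-c) ≤ (1 + ζ⁻¹) ^ c * ((1 + t) ^ 2)⁻¹ := by
  have h1 : 0 < 1 + t := by linarith
  have h2 : 0 < ζ + t := by linarith
  have h3 : (1 + t) / (ζ + t) ≤ 1 + ζ⁻¹ := by
    rw [div_le_iff₀ h2]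
    have : 0 ≤ ζ⁻¹ * t := by positivity
    have : ζ⁻¹ * ζ = 1 := inv_mul_cancel₀ hζ.ne'
    nlinarith
  have h4 : (1 + t) ^ (c - 2) * (ζ + t) ^ (-c) = ((1 + t) / (ζ + t)) ^ c * ((1 + t) ^ 2)⁻¹ := by
    rw [Real.div_rpow h1.le h2.le, Real.rpow_sub h1, Real.rpow_neg h2.le]
    norm_num
    ring
  rw [h4]
  exact mul_le_mul_of_nonneg_right (Real.rpow_le_rpow (by positivity) h3 hc.le) (by positivity)

/-- The incomplete Beta integral is bounded by the absolute integral over the whole half-line, and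
the weight is `O((1 + t)^(-2))`. -/
theorem integrableOn_rpow_mul_incompleteBetaPrime {a : ℂ} (ha : -1 < a.re) {c ζ : ℝ}
    (hc0 : 0 < c) (hac : a.re < c) (hζ : 0 < ζ) :
    IntegrableOn (fun t : ℝ => (((1 + t) ^ (c - 2) * (ζ + t) ^ (-c) : ℝ) : ℂ) *
      incompleteBetaPrime a (c + 1 : ℝ) t) (Ioi 0) := by
  set B := ∫ u in Ioi (0 : ℝ), ‖(((1 + u) ^ (-(c + 1)) : ℝ) : ℂ) * (u : ℂ) ^ a‖ with hB
  have hbound : ∀ t ∈ Ioi (0 : ℝ), ‖(((1 + t) ^ (c - 2) * (ζ + t) ^ (-c) : ℝ) : ℂ) *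
      incompleteBetaPrime a (c + 1 : ℝ) t‖ ≤ (1 + ζ⁻¹) ^ c * ((1 + t) ^ 2)⁻¹ * B := by
    intro t ht
    have ht0 : 0 < t := ht
    rw [norm_mul, norm_real, Real.norm_of_nonneg (by positivity)]
    exact mul_le_mul (rpow_one_add_mul_rpow_le hc0 hζ ht0.le)
      (norm_incompleteBetaPrime_le ha (by linarith) ht0.le) (norm_nonneg _) (by positivity)
  have hB0 : 0 ≤ B := integral_nonneg fun _ => norm_nonneg _
  refine integrableOn_Ioi_of_norm_le (σ := 0) (τ := -2) (C := (1 + ζ⁻¹) ^ c * B)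
    (K := (1 + ζ⁻¹) ^ c * B) ?_ (by norm_num) (by norm_num) ?_ ?_
  · refine ContinuousOn.mul ?_
      ((continuousOn_incompleteBetaPrime ha _).mono Ioi_subset_Ici_self)
    have h1 := (continuousOn_add_rpow_Ioi one_pos (c - 2)).mono (Ioi_subset_Ici_self (a := (0 : ℝ)))
    have h2 := (continuousOn_add_rpow_Ioi hζ (-c)).mono (Ioi_subset_Ici_self (a := (0 : ℝ)))
    refine (h1.mul h2).congr fun t _ => ?_
    simp
  · intro t ht
    have ht0 : 0 < t := ht.1
    refine (hbound t ht0).trans ?_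
    rw [Real.rpow_zero, mul_one, mul_right_comm]
    refine mul_le_of_le_one_right (by positivity) (inv_le_one_of_one_le₀ ?_)
    nlinarith
  · intro t ht
    have ht0 : 0 < t := zero_lt_one.trans ht
    refine (hbound t ht0).trans ?_
    rw [mul_right_comm]
    refine mul_le_mul_of_nonneg_left ?_ (by positivity)
    rw [Real.rpow_neg ht0.le, show (2 : ℝ) = (2 : ℕ) by norm_num, Real.rpow_natCast]
    gcongr
    linarith

/-- The integrand is `O(t^(Re a))` near `0` and `O(t^(Re a - 1 - c))` at infinity. -/
theorem integrableOn_algebraic_part {a b : ℂ} (ha : -1 < a.re) {c ζ : ℝ} (hc0 : 0 < c)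
    (hac : a.re < c) (hζ : 0 < ζ) :
    IntegrableOn (fun t : ℝ => (((ζ + t) ^ (-c) : ℝ) : ℂ) *
      ((b - a * t) * (((1 + t) ^ 2)⁻¹ : ℝ) * (t : ℂ) ^ a)) (Ioi 0) := by
  have hbase : ∀ t ∈ Ioi (0 : ℝ), ‖(((ζ + t) ^ (-c) : ℝ) : ℂ) *
      ((b - a * t) * (((1 + t) ^ 2)⁻¹ : ℝ) * (t : ℂ) ^ a)‖ ≤
      (‖b‖ + ‖a‖) * ((ζ + t) ^ (-c) * ((1 + t)⁻¹ * t ^ a.re)) := by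
    intro t ht
    have ht0 : 0 < t := ht
    rw [norm_mul, norm_mul, norm_mul, norm_real, norm_real, norm_cpow_eq_rpow_re_of_pos ht0,
      Real.norm_of_nonneg (by positivity), Real.norm_of_nonneg (by positivity)]
    have h1 : ‖b - a * t‖ ≤ (‖b‖ + ‖a‖) * (1 + t) := by
      refine (norm_sub_le _ _).trans ?_
      rw [norm_mul, norm_real, Real.norm_of_nonneg ht0.le]
      nlinarith [norm_nonneg a, norm_nonneg b]
    calc (ζ + t) ^ (-c) * (‖b - a * t‖ * ((1 + t) ^ 2)⁻¹ * t ^ a.re)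
        ≤ (ζ + t) ^ (-c) * ((‖b‖ + ‖a‖) * (1 + t) * ((1 + t) ^ 2)⁻¹ * t ^ a.re) := by gcongr
      _ = _ := by field_simp
  refine integrableOn_Ioi_of_norm_le (σ := a.re) (τ := a.re - 1 - c)
    (C := (‖b‖ + ‖a‖) * ζ ^ (-c)) (K := ‖b‖ + ‖a‖) ?_ ha (by linarith) ?_ ?_
  · refine ((continuousOn_add_rpow_Ioi hζ (-c)).mono Ioi_subset_Ici_self).mul
      (ContinuousOn.mul (ContinuousOn.mul (by fun_prop) ?_) (continuousOn_ofReal_cpow_Ioi a))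
    refine continuous_ofReal.comp_continuousOn (ContinuousOn.inv₀ (by fun_prop) fun t ht => ?_)
    have ht0 : 0 < t := ht
    positivity
  · intro t ht
    have ht0 : 0 < t := ht.1
    refine (hbase t ht0).trans ?_
    rw [mul_assoc]
    have h1 : (ζ + t) ^ (-c) ≤ ζ ^ (-c) :=
      Real.rpow_le_rpow_of_nonpos hζ (by linarith) (by linarith)
    have h2 : (1 + t)⁻¹ * t ^ a.re ≤ t ^ a.re :=
      mul_le_of_le_one_left (by positivity) (inv_le_one_of_one_le₀ (by linarith))
    gcongr
  · intro t ht
    have ht0 : 0 < t := zero_lt_one.trans ht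
    refine (hbase t ht0).trans ?_
    refine mul_le_mul_of_nonneg_left ?_ (by positivity)
    have h1 : (ζ + t) ^ (-c) ≤ t ^ (-c) :=
      Real.rpow_le_rpow_of_nonpos ht0 (by linarith) (by linarith)
    have h2 : (1 + t)⁻¹ ≤ t⁻¹ := by gcongr; linarith
    calc (ζ + t) ^ (-c) * ((1 + t)⁻¹ * t ^ a.re) ≤ t ^ (-c) * (t⁻¹ * t ^ a.re) := by gcongr
      _ = t ^ (a.re - 1 - c) := by
        rw [← Real.rpow_neg_one, ← Real.rpow_add ht0, ← Real.rpow_add ht0]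
        ring_nf

theorem integrableOn_rpow_mul_binomialTail {a b : ℂ} (ha : -1 < a.re) (hb : -1 < b.re) {c : ℝ}
    (hc : a + b + 1 = c) (hc0 : 0 < c) {ζ : ℝ} (hζ : 0 < ζ) :
    IntegrableOn (fun t : ℝ => (((ζ + t) ^ (-c) : ℝ) : ℂ) *
      ((t : ℂ) ^ a * binomialTail a b (-t))) (Ioi 0) := by
  have hre : a.re + b.re + 1 = c := by simpa using congrArg re hc
  have h1 := integrableOn_algebraic_part (b := b) ha hc0 (by linarith) hζ
  have h2 := (integrableOn_rpow_mul_incompleteBetaPrime ha hc0 (by linarith) hζ).const_mul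
    ((c : ℂ) * (c - 1))
  refine ((h1.add h2).mul_const ((Gamma (a + 1))⁻¹ * (Gamma (b + 1))⁻¹)).congr ?_
  filter_upwards [ae_restrict_mem measurableSet_Ioi] with t ht
  rw [cpow_mul_binomialTail hc ht]
  simp only [Pi.add_apply]
  push_cast
  ring

/-! ### Evaluation of the transform. -/

/-- The primitive that evaluates the Stieltjes-type transform of the continued series. -/
theorem hasDerivAt_stieltjesPrimitive {a b : ℂ} (ha : -1 < a.re) {c : ℝ} (hc : a + b + 1 = c)
    {ζ t : ℝ} (hζ : 0 < ζ) (ht : 0 < t) :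
    HasDerivAt (fun t : ℝ => c * ((((1 + t) ^ (c - 1) * (ζ + t) ^ (1 - c) : ℝ) : ℂ) *
        incompleteBetaPrime a (c + 1 : ℝ) t) +
        (1 - ζ) * ((((1 + t)⁻¹ * (ζ + t) ^ (-c) : ℝ) : ℂ) * (t : ℂ) ^ (a + 1)))
      ((ζ - 1) * ((((ζ + t) ^ (-c) : ℝ) : ℂ) * ((b - a * t) * (((1 + t) ^ 2)⁻¹ : ℝ) * (t : ℂ) ^ a +
        c * (c - 1) * ((1 + t) ^ (c - 2) : ℝ) * incompleteBetaPrime a (c + 1 : ℝ) t)) +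
        c * ζ * ((((ζ + t) ^ (-(c + 1)) : ℝ) : ℂ) * (t : ℂ) ^ a)) t := by
  have h1 : 0 < 1 + t := by linarith
  have h2 : 0 < ζ + t := by linarith
  have d1 : HasDerivAt (fun t : ℝ => 1 + t) 1 t := by simpa using (hasDerivAt_id t).const_add 1
  have d2 : HasDerivAt (fun t : ℝ => ζ + t) 1 t := by simpa using (hasDerivAt_id t).const_add ζ
  -- The derivative of `((1 + t) / (ζ + t))^(c - 1)` is `(c - 1) (ζ - 1) (1 + t)^(c - 2) (ζ +
  -- t)^(-c)`, the weight of the incomplete Beta integral in the transform. The second summand of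
  -- the primitive absorbs elementary terms, leaving only a Beta integrand.
  have dU := ((d1.rpow_const (p := c - 1) (Or.inl h1.ne')).mul
    (d2.rpow_const (p := 1 - c) (Or.inl h2.ne'))).ofReal_comp
  have dX := ((d1.inv h1.ne').mul (d2.rpow_const (p := -c) (Or.inl h2.ne'))).ofReal_comp
  have ha1 : a + 1 ≠ 0 := fun h => by
    have := congrArg re h
    simp at this
    linarith
  have dt : HasDerivAt (fun t : ℝ => (t : ℂ) ^ (a + 1)) ((a + 1) * (t : ℂ) ^ a) t := by
    simpa using hasDerivAt_ofReal_cpow_const ht.ne' ha1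
  have dD := hasDerivAt_incompleteBetaPrime ha (c + 1) ht
  refine (((dU.mul dD).const_mul (c : ℂ)).add ((dX.mul dt).const_mul (1 - (ζ : ℂ)))).congr_deriv ?_
  have p1 : (1 + t) ^ (c - 1) = (1 + t) ^ (c - 2) * (1 + t) := by
    rw [← Real.rpow_add_one h1.ne']; ring_nf
  have p2 : (1 + t) ^ (c - 1 - 1) = (1 + t) ^ (c - 2) := by ring_nf
  have p3 : (1 + t) ^ (-(c + 1)) * (1 + t) ^ (c - 2) = ((1 + t) ^ 3)⁻¹ := by
    rw [← Real.rpow_add h1, show -(c + 1) + (c - 2) = -((3 : ℕ) : ℝ) by push_cast; ring,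
      Real.rpow_neg h1.le, Real.rpow_natCast]
  have q1 : (ζ + t) ^ (-c) = (ζ + t) ^ (-(c + 1)) * (ζ + t) := by
    rw [← Real.rpow_add_one h2.ne']; ring_nf
  have q2 : (ζ + t) ^ (1 - c) = (ζ + t) ^ (-(c + 1)) * (ζ + t) ^ 2 := by
    rw [← Real.rpow_natCast, ← Real.rpow_add h2]; push_cast; ring_nf
  have q3 : (ζ + t) ^ (-c - 1) = (ζ + t) ^ (-(c + 1)) := by ring_nf
  have q4 : (ζ + t) ^ (1 - c - 1) = (ζ + t) ^ (-(c + 1)) * (ζ + t) := by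
    rw [← Real.rpow_add_one h2.ne']; ring_nf
  have ht' : (t : ℂ) ^ (a + 1) = (t : ℂ) ^ a * t := by
    rw [cpow_add _ _ (ofReal_ne_zero.2 ht.ne'), cpow_one]
  simp only [Pi.mul_apply, Pi.inv_apply, p1, p2, q1, q2, q3, q4, ht']
  have p3' := congrArg (fun x : ℝ => (x : ℂ)) p3
  have h1' : (1 + (t : ℂ)) ≠ 0 := by exact_mod_cast h1.ne'
  push_cast at p3' ⊢
  have hb : b = c - 1 - a := by linear_combination hc
  clear dU dX dD dt d1 d2 p1 p2 q1 q2 q3 q4 p3 ht' hc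
  subst hb
  generalize incompleteBetaPrime a (c + 1) t = D at *
  generalize (((1 + t) ^ (c - 2) : ℝ) : ℂ) = E at *
  generalize (((1 + t) ^ (-(c + 1)) : ℝ) : ℂ) = E' at *
  generalize (((ζ + t) ^ (-(c + 1)) : ℝ) : ℂ) = R at *
  generalize (t : ℂ) ^ a = T at *
  field_simp at p3' ⊢
  linear_combination (c * R * (ζ + t) ^ 2 * T) * p3'

theorem tendsto_one_add_rpow_mul {ζ : ℝ} (hζ : 0 < ζ) (c : ℝ) :
    Tendsto (fun t : ℝ => (1 + t) ^ (c - 1) * (ζ + t) ^ (1 - c)) atTop (𝓝 1) := by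
  have h1 : Tendsto (fun t : ℝ => 1 + (1 - ζ) / (ζ + t)) atTop (𝓝 1) := by
    simpa using (tendsto_const_nhds.div_atTop
      (tendsto_atTop_add_const_left atTop ζ tendsto_id)).const_add (1 : ℝ)
  have h2 := h1.rpow_const (p := c - 1) (Or.inl one_ne_zero)
  rw [Real.one_rpow] at h2
  refine h2.congr' ?_
  filter_upwards [eventually_gt_atTop 0] with t ht
  have h3 : 0 < ζ + t := by linarith
  rw [show 1 + (1 - ζ) / (ζ + t) = (1 + t) / (ζ + t) by field_simp; ring,
    Real.div_rpow (by linarith) h3.le, div_eq_mul_inv, ← Real.rpow_neg h3.le, neg_sub]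

theorem tendsto_stieltjes_remainder {a : ℂ} {c ζ : ℝ} (hc0 : 0 < c) (hac : a.re < c)
    (hζ : 0 < ζ) :
    Tendsto (fun t : ℝ => (((1 + t)⁻¹ * (ζ + t) ^ (-c) : ℝ) : ℂ) * (t : ℂ) ^ (a + 1)) atTop
      (𝓝 0) := by
  refine squeeze_zero_norm' ?_ (tendsto_rpow_neg_atTop (y := c - a.re) (by linarith))
  filter_upwards [eventually_gt_atTop 0] with t ht
  rw [norm_mul, norm_real, norm_cpow_eq_rpow_re_of_pos ht, Real.norm_of_nonneg (by positivity)]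
  have h1 : (ζ + t) ^ (-c) ≤ t ^ (-c) :=
    Real.rpow_le_rpow_of_nonpos ht (by linarith) (by linarith)
  have h2 : (1 + t)⁻¹ ≤ t⁻¹ := by gcongr; linarith
  calc (1 + t)⁻¹ * (ζ + t) ^ (-c) * t ^ (a + 1).re ≤ t⁻¹ * t ^ (-c) * t ^ (a + 1).re := by gcongr
    _ = t ^ (-(c - a.re)) := by
      rw [← Real.rpow_neg_one, ← Real.rpow_add ht, ← Real.rpow_add ht, add_re, one_re]
      ring_nf

/-- The Stieltjes-type transform of the continued series. -/
theorem integral_rpow_mul_binomialTail {a b : ℂ} (ha : -1 < a.re) (hb : -1 < b.re) {c : ℝ}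
    (hc : a + b + 1 = c) (hc0 : 0 < c) {ζ : ℝ} (hζ : 0 < ζ) :
    (ζ - 1) * ∫ t in Ioi (0 : ℝ), (((ζ + t) ^ (-c) : ℝ) : ℂ) *
      ((t : ℂ) ^ a * binomialTail a b (-t)) = (1 - (ζ : ℂ) ^ (-b)) / Gamma c := by
  have hre : a.re + b.re + 1 = c := by simpa using congrArg re hc
  have hc1 : a + b + 2 = (c + 1 : ℝ) := by push_cast; linear_combination hc
  have hΓa : Gamma (a + 1) ≠ 0 := Gamma_ne_zero_of_re_pos (by simp; linarith)
  have hΓb : Gamma (b + 1) ≠ 0 := Gamma_ne_zero_of_re_pos (by simp; linarith)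
  have hΓc : Gamma (c : ℂ) ≠ 0 := Gamma_ne_zero_of_re_pos (by simpa using hc0)
  have hc' : (c : ℂ) ≠ 0 := ofReal_ne_zero.2 hc0.ne'
  have i1 := integrableOn_rpow_mul_binomialTail ha hb hc hc0 hζ
  have i2 := integrableOn_betaPrime ha (m := c + 1) (by linarith) hζ
  set W := fun t : ℝ => (b - a * t) * (((1 + t) ^ 2)⁻¹ : ℝ) * (t : ℂ) ^ a +
    c * (c - 1) * ((1 + t) ^ (c - 2) : ℝ) * incompleteBetaPrime a (c + 1 : ℝ) t with hW
  have hWeq : EqOn (fun t : ℝ => (((ζ + t) ^ (-c) : ℝ) : ℂ) * W t)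
      (fun t : ℝ => Gamma (a + 1) * Gamma (b + 1) *
        ((((ζ + t) ^ (-c) : ℝ) : ℂ) * ((t : ℂ) ^ a * binomialTail a b (-t)))) (Ioi 0) := by
    intro t ht
    simp only [cpow_mul_binomialTail hc ht, hW]
    field_simp
  have i3 : IntegrableOn (fun t : ℝ => (((ζ + t) ^ (-c) : ℝ) : ℂ) * W t) (Ioi 0) :=
    IntegrableOn.congr_fun (i1.const_mul (Gamma (a + 1) * Gamma (b + 1))) hWeq.symm
      measurableSet_Ioi
  have hcont : ContinuousWithinAt (fun t : ℝ => c * ((((1 + t) ^ (c - 1) * (ζ + t) ^ (1 - c) : ℝ) :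
        ℂ) * incompleteBetaPrime a (c + 1 : ℝ) t) +
        (1 - ζ) * ((((1 + t)⁻¹ * (ζ + t) ^ (-c) : ℝ) : ℂ) * (t : ℂ) ^ (a + 1))) (Ici 0) 0 := by
    have c1 := (continuousOn_incompleteBetaPrime ha (c + 1 : ℝ)) 0 self_mem_Ici
    have c2 : ContinuousAt (fun t : ℝ => (t : ℂ) ^ (a + 1)) 0 :=
      (continuous_ofReal_cpow_const (by simp; linarith)).continuousAt
    have c3 : ContinuousAt (fun t : ℝ => (1 + t) ^ (c - 1) * (ζ + t) ^ (1 - c)) 0 :=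
      (ContinuousAt.rpow_const (by fun_prop) (Or.inl (by simp))).mul
        (ContinuousAt.rpow_const (by fun_prop) (Or.inl (by simpa using hζ.ne')))
    have c4 : ContinuousAt (fun t : ℝ => (1 + t)⁻¹ * (ζ + t) ^ (-c)) 0 :=
      (ContinuousAt.inv₀ (by fun_prop) (by simp)).mul
        (ContinuousAt.rpow_const (by fun_prop) (Or.inl (by simpa using hζ.ne')))
    exact (continuousWithinAt_const.mul
      ((continuous_ofReal.continuousAt.comp c3).continuousWithinAt.mul c1)).add
      (continuousWithinAt_const.mul
        ((continuous_ofReal.continuousAt.comp c4).continuousWithinAt.mul c2.continuousWithinAt))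
  have hlim := (((continuous_ofReal.tendsto 1).comp (tendsto_one_add_rpow_mul hζ c)).mul
    (tendsto_incompleteBetaPrime ha hb hc1)).const_mul (c : ℂ) |>.add
    ((tendsto_stieltjes_remainder (a := a) hc0 (by linarith) hζ).const_mul (1 - (ζ : ℂ)))
  -- The primitive vanishes at `0` and tends to `c Γ(a + 1) Γ(b + 1) / Γ(c + 1)`; the Beta integral
  -- with parameter `ζ` supplies the term `ζ^(-b)`.
  have key := integral_Ioi_of_hasDerivAt_of_tendsto hcont
    (fun t ht => hasDerivAt_stieltjesPrimitive ha hc hζ ht)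
    ((i3.const_mul ((ζ : ℂ) - 1)).add (i2.const_mul ((c : ℂ) * ζ))) hlim
  have ha1 : a + 1 ≠ 0 := fun h => by
    have := congrArg re h
    simp at this
    linarith
  rw [integral_add (i3.const_mul ((ζ : ℂ) - 1)) (i2.const_mul ((c : ℂ) * ζ)), integral_const_mul,
    integral_const_mul, setIntegral_congr_fun measurableSet_Ioi hWeq, integral_const_mul,
    integral_betaPrime ha hb hc1 hζ, incompleteBetaPrime_zero ha, ofReal_zero, zero_cpow ha1] at key
  have hΓ1 : Gamma ((c + 1 : ℝ) : ℂ) = c * Gamma c := by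
    push_cast
    exact Gamma_add_one _ hc'
  have hζb : (ζ : ℂ) * (ζ : ℂ) ^ (-(b + 1)) = (ζ : ℂ) ^ (-b) := by
    have := cpow_add (x := (ζ : ℂ)) 1 (-(b + 1)) (ofReal_ne_zero.2 hζ.ne')
    rw [cpow_one] at this
    rw [← this]
    ring_nf
  rw [hΓ1] at key
  rw [← hζb]
  generalize ∫ t in Ioi (0 : ℝ), (((ζ + t) ^ (-c) : ℝ) : ℂ) *
      ((t : ℂ) ^ a * binomialTail a b (-t)) = J at *
  field_simp at key ⊢
  push_cast at key
  apply mul_left_cancel₀ (mul_ne_zero hΓa hΓb)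
  linear_combination key

/-! ### Gamma laws and the expectation. -/

theorem gammaMeasure_eq_withDensity_restrict (a r : ℝ) :
    gammaMeasure a r = (volume.restrict (Ioi 0)).withDensity (gammaPDF a r) := by
  rw [gammaMeasure, ← withDensity_indicator measurableSet_Ioi]
  refine withDensity_congr_ae ?_
  filter_upwards [Measure.ae_ne volume (0 : ℝ)] with x hx
  by_cases h : 0 < x
  · rw [indicator_of_mem (show x ∈ Ioi 0 from h)]
  · rw [indicator_of_notMem (show x ∉ Ioi 0 from h),
      gammaPDF_of_neg (lt_of_le_of_ne (not_lt.1 h) hx)]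

theorem prod_gammaMeasure (a r b q : ℝ) :
    (gammaMeasure a r).prod (gammaMeasure b q) =
      ((volume.restrict (Ioi 0)).prod (volume.restrict (Ioi 0))).withDensity
        fun p => gammaPDF a r p.1 * gammaPDF b q p.2 := by
  rw [gammaMeasure_eq_withDensity_restrict, gammaMeasure_eq_withDensity_restrict]
  exact prod_withDensity (measurable_gammaPDFReal a r).ennreal_ofReal
    (measurable_gammaPDFReal b q).ennreal_ofReal

theorem ae_prod_gammaMeasure (a r b q : ℝ) :
    ∀ᵐ p ∂(gammaMeasure a r).prod (gammaMeasure b q), p ∈ Ioi (0 : ℝ) ×ˢ Ioi (0 : ℝ) := by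
  rw [prod_gammaMeasure]
  refine (withDensity_absolutelyContinuous _ _).ae_le ?_
  rw [Measure.prod_restrict]
  exact ae_restrict_mem (measurableSet_Ioi.prod measurableSet_Ioi)

theorem integrable_and_integral_prod_gammaMeasure {a r b q : ℝ} (ha : 0 < a) (hr : 0 < r)
    (hb : 0 < b) (hq : 0 < q) (f : ℝ × ℝ → ℂ) :
    (Integrable f ((gammaMeasure a r).prod (gammaMeasure b q)) ↔
      Integrable (fun p => (gammaPDFReal a r p.1 * gammaPDFReal b q p.2) • f p)
        ((volume.restrict (Ioi 0)).prod (volume.restrict (Ioi 0)))) ∧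
    ∫ p, f p ∂(gammaMeasure a r).prod (gammaMeasure b q) =
      ∫ p, (gammaPDFReal a r p.1 * gammaPDFReal b q p.2) • f p
        ∂((volume.restrict (Ioi 0)).prod (volume.restrict (Ioi 0))) := by
  have hm : Measurable fun p : ℝ × ℝ => gammaPDF a r p.1 * gammaPDF b q p.2 :=
    ((measurable_gammaPDFReal a r).ennreal_ofReal.comp measurable_fst).mul
      ((measurable_gammaPDFReal b q).ennreal_ofReal.comp measurable_snd)
  have hlt : ∀ p : ℝ × ℝ, gammaPDF a r p.1 * gammaPDF b q p.2 < ⊤ := fun p =>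
    ENNReal.mul_lt_top ENNReal.ofReal_lt_top ENNReal.ofReal_lt_top
  have hval : ∀ p : ℝ × ℝ, (gammaPDF a r p.1 * gammaPDF b q p.2).toReal =
      gammaPDFReal a r p.1 * gammaPDFReal b q p.2 := fun p => by
    rw [ENNReal.toReal_mul, gammaPDF, gammaPDF, ENNReal.toReal_ofReal (gammaPDFReal_nonneg ha hr _),
      ENNReal.toReal_ofReal (gammaPDFReal_nonneg hb hq _)]
  rw [prod_gammaMeasure, integrable_withDensity_iff_integrable_smul' hm (ae_of_all _ hlt),
    integral_withDensity_eq_integral_toReal_smul hm (ae_of_all _ hlt)]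
  simp only [hval, and_self]

theorem continuousOn_gammaPDFReal (a r : ℝ) : ContinuousOn (gammaPDFReal a r) (Ioi 0) := by
  have h : ContinuousOn (fun x : ℝ => r ^ a / Real.Gamma a * x ^ (a - 1) * Real.exp (-(r * x)))
      (Ioi 0) := by
    refine ContinuousOn.mul (ContinuousOn.mul continuousOn_const ?_) (by fun_prop)
    exact continuousOn_id.rpow_const fun x hx => Or.inl (ne_of_gt hx)
  refine h.congr fun x hx => ?_
  rw [gammaPDFReal, if_pos (le_of_lt hx)]

theorem continuousOn_estimatorTerm {α₁ α₂ : ℝ} (h₁ : 0 < α₁) (h₂ : 0 < α₂) {s : ℂ}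
    (hs : -α₂ < s.re) :
    ContinuousOn (fun p : ℝ × ℝ => estimatorTerm α₁ α₂ s p.1 p.2) (Ioi 0 ×ˢ Ioi 0) := by
  intro p hp
  refine ContinuousAt.continuousWithinAt ?_
  exact ContinuousAt.comp (g := fun p : ℝ × ℝ × ℝ => estimatorTerm p.1 α₂ s p.2.1 p.2.2)
    (f := fun p : ℝ × ℝ => (α₁, p.1, p.2)) (continuousAt_estimatorTerm h₁ h₂ hs hp.1 hp.2)
    (by fun_prop)

/-- The gamma densities times the estimator, in the coordinates `(y₁, t)` with
`α₁ y₁ t = α₂ y₂`. -/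
theorem gammaPDFReal_smul_estimatorTerm {α₁ α₂ κ₁ κ₂ : ℝ} (h₁ : 0 < α₁) (h₂ : 0 < α₂)
    (hκ₁ : 0 < κ₁) (hκ₂ : 0 < κ₂) (s : ℂ) {x t : ℝ} (hx : 0 < x) (ht : 0 < t) :
    (α₁ / α₂ * x) • ((gammaPDFReal α₁ (α₁ / κ₁) x *
        gammaPDFReal α₂ (α₂ / κ₂) (α₁ / α₂ * x * t)) •
          estimatorTerm α₁ α₂ s x (α₁ / α₂ * x * t)) =
      (((α₁ / κ₁) ^ α₁ * (α₁ / κ₂) ^ α₂ / α₁ : ℝ) : ℂ) *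
        (((x ^ (α₁ + α₂ - 1 - 1) * Real.exp (-((α₁ / κ₁ + α₁ / κ₂ * t) * x)) : ℝ) : ℂ) *
          ((t : ℂ) ^ (α₂ - 1 + s) * binomialTail (α₂ - 1 + s) (α₁ - 1 - s) (-t))) := by
  have hk : 0 < α₁ / α₂ := by positivity
  have hy : 0 < α₁ / α₂ * x * t := by positivity
  have ht' : (t : ℂ) ≠ 0 := ofReal_ne_zero.2 ht.ne'
  have hΓ₁ := (Real.Gamma_pos_of_pos h₁).ne'
  have hΓ₂ := (Real.Gamma_pos_of_pos h₂).ne'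
  rw [gammaPDFReal, gammaPDFReal, if_pos hx.le, if_pos hy.le, estimatorTerm,
    show α₂ * (α₁ / α₂ * x * t) / (α₁ * x) = t by field_simp, cpow_add _ _ ht',
    show (α₂ : ℂ) - 1 = ((α₂ - 1 : ℝ) : ℂ) by push_cast; ring, ← ofReal_cpow ht.le,
    Gamma_ofReal, Gamma_ofReal, smul_smul, real_smul]
  have e1 : (α₁ / α₂ * x * t) ^ (α₂ - 1) =
      (α₁ / α₂) ^ α₂ * (α₁ / α₂)⁻¹ * x ^ (α₂ - 1) * t ^ (α₂ - 1) := by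
    rw [Real.mul_rpow (by positivity) ht.le, Real.mul_rpow hk.le hx.le, Real.rpow_sub_one hk.ne']
    ring
  have e2 : (α₁ / κ₂) ^ α₂ = (α₁ / α₂) ^ α₂ * (α₂ / κ₂) ^ α₂ := by
    rw [← Real.mul_rpow hk.le (by positivity)]
    congr 1
    field_simp
  have e3 : x ^ (α₁ + α₂ - 1 - 1) = x ^ (α₁ - 1) * x ^ (α₂ - 1) := by
    rw [← Real.rpow_add hx]
    ring_nf
  have e4 : Real.exp (-((α₁ / κ₁ + α₁ / κ₂ * t) * x)) = Real.exp (-(α₁ / κ₁ * x)) *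
      Real.exp (-(α₂ / κ₂ * (α₁ / α₂ * x * t))) := by
    rw [← Real.exp_add]
    congr 1
    field_simp
    ring
  rw [e1, e2, e3, e4]
  have hc : α₁ / α₂ * x * ((α₁ / κ₁) ^ α₁ / Real.Gamma α₁ * x ^ (α₁ - 1) *
      Real.exp (-(α₁ / κ₁ * x)) * ((α₂ / κ₂) ^ α₂ / Real.Gamma α₂ *
      ((α₁ / α₂) ^ α₂ * (α₁ / α₂)⁻¹ * x ^ (α₂ - 1) * t ^ (α₂ - 1)) *
      Real.exp (-(α₂ / κ₂ * (α₁ / α₂ * x * t))))) * (Real.Gamma α₁ * Real.Gamma α₂ / (α₁ * x)) =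
      (α₁ / κ₁) ^ α₁ * ((α₁ / α₂) ^ α₂ * (α₂ / κ₂) ^ α₂) / α₁ * (x ^ (α₁ - 1) * x ^ (α₂ - 1) *
        (Real.exp (-(α₁ / κ₁ * x)) * Real.exp (-(α₂ / κ₂ * (α₁ / α₂ * x * t))))) *
          t ^ (α₂ - 1) := by
    generalize Real.exp (-(α₂ / κ₂ * (α₁ / α₂ * x * t))) = E
    generalize Real.exp (-(α₁ / κ₁ * x)) = E'
    generalize x ^ (α₁ - 1) = X₁
    generalize x ^ (α₂ - 1) = X₂
    generalize (α₁ / κ₁) ^ α₁ = K₁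
    generalize (α₂ / κ₂) ^ α₂ = K₂
    generalize (α₁ / α₂) ^ α₂ = K₃
    generalize t ^ (α₂ - 1) = Z
    field_simp
  have hc' := congrArg (fun r : ℝ => (r : ℂ)) hc
  simp only [ofReal_mul, ofReal_div] at hc' ⊢
  linear_combination (t : ℂ) ^ s * binomialTail (((α₂ - 1 : ℝ) : ℂ) + s) (α₁ - 1 - s) (-t) * hc'

/-- The Jacobian of `(y₁, t) ↦ (y₁, y₂)` cancels the factor `1 / y₁` of the estimator, so the power
of `y₁` is `c - 1` with `c = α₁ + α₂ - 1`. The Gamma factor from integrating `y₁` cancels the `1 /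
Γ(c)` of the transform. -/
theorem integrable_and_integral_estimatorTerm {α₁ α₂ κ₁ κ₂ : ℝ} (h₁ : 0 < α₁) (h₂ : 0 < α₂)
    (hα : 1 < α₁ + α₂) (hκ₁ : 0 < κ₁) (hκ₂ : 0 < κ₂) (hκ : κ₁ ≠ κ₂) {s : ℂ} (hs₁ : -α₂ < s.re)
    (hs₂ : s.re < α₁) :
    Integrable (fun p : ℝ × ℝ => estimatorTerm α₁ α₂ s p.1 p.2)
      ((gammaMeasure α₁ (α₁ / κ₁)).prod (gammaMeasure α₂ (α₂ / κ₂))) ∧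
    ∫ p, estimatorTerm α₁ α₂ s p.1 p.2
        ∂((gammaMeasure α₁ (α₁ / κ₁)).prod (gammaMeasure α₂ (α₂ / κ₂))) =
      (((κ₂ / κ₁) ^ α₁ / κ₂ : ℝ) : ℂ) *
        ((1 - ((κ₂ / κ₁ : ℝ) : ℂ) ^ (1 - α₁ + s)) / (((κ₂ / κ₁ : ℝ) : ℂ) - 1)) := by
  have hζ : 0 < κ₂ / κ₁ := by positivity
  have hc0 : 0 < α₁ + α₂ - 1 := by linarith
  have ha : -1 < ((α₂ : ℂ) - 1 + s).re := by simp; linarith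
  have hb : -1 < ((α₁ : ℂ) - 1 - s).re := by simp; linarith
  have hc : ((α₂ : ℂ) - 1 + s) + ((α₁ : ℂ) - 1 - s) + 1 = ((α₁ + α₂ - 1 : ℝ) : ℂ) := by
    push_cast; ring
  have hq : 0 < α₁ / κ₂ := by positivity
  set w := fun t : ℝ => (t : ℂ) ^ ((α₂ : ℂ) - 1 + s) *
    binomialTail (α₂ - 1 + s) (α₁ - 1 - s) (-t) with hw
  have hwc : ContinuousOn w (Ioi 0) := by
    refine (continuousOn_ofReal_cpow_Ioi _).mul fun t ht => ?_
    obtain ⟨g', hg', -⟩ := binomialTail_hasDerivAt (b := (α₁ : ℂ) - 1 - s) ha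
      (one_sub_neg_ofReal_mem_slitPlane (le_of_lt ht))
    exact (ContinuousAt.comp (g := binomialTail (α₂ - 1 + s) (α₁ - 1 - s))
      (f := fun t : ℝ => -(t : ℂ)) hg'.continuousAt (by fun_prop)).continuousWithinAt
  have hker : EqOn (fun t : ℝ => (((α₁ / κ₁ + α₁ / κ₂ * t) ^ (-(α₁ + α₂ - 1)) : ℝ) : ℂ) * w t)
      (fun t : ℝ => (((α₁ / κ₂) ^ (-(α₁ + α₂ - 1)) : ℝ) : ℂ) *
        ((((κ₂ / κ₁ + t) ^ (-(α₁ + α₂ - 1)) : ℝ) : ℂ) * w t)) (Ioi 0) := by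
    intro t ht
    have ht0 : 0 < t := ht
    have hr : (α₁ / κ₁ + α₁ / κ₂ * t) ^ (-(α₁ + α₂ - 1)) =
        (α₁ / κ₂) ^ (-(α₁ + α₂ - 1)) * (κ₂ / κ₁ + t) ^ (-(α₁ + α₂ - 1)) := by
      rw [← Real.mul_rpow hq.le (by positivity)]
      congr 1
      field_simp
    simp only [hr, ofReal_mul, mul_assoc]
  have hJ := integrableOn_rpow_mul_binomialTail ha hb hc hc0 hζ
  obtain ⟨k1, k2⟩ := integrable_prod_gamma_kernel hc0 (p := α₁ / κ₁) (q := α₁ / κ₂) (by positivity)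
    hq hwc (IntegrableOn.congr_fun (hJ.const_mul _) hker.symm measurableSet_Ioi)
  obtain ⟨g1, g2⟩ := integrable_and_integral_prod_gammaMeasure h₁ (div_pos h₁ hκ₁) h₂
    (div_pos h₂ hκ₂) (fun p : ℝ × ℝ => estimatorTerm α₁ α₂ s p.1 p.2)
  have hcomp : (fun p : ℝ × ℝ => (α₁ / α₂ * p.1) • ((gammaPDFReal α₁ (α₁ / κ₁) p.1 *
        gammaPDFReal α₂ (α₂ / κ₂) (α₁ / α₂ * p.1 * p.2)) •
          estimatorTerm α₁ α₂ s p.1 (α₁ / α₂ * p.1 * p.2))) =ᵐ[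
      (volume.restrict (Ioi 0)).prod (volume.restrict (Ioi 0))] fun p =>
      (((α₁ / κ₁) ^ α₁ * (α₁ / κ₂) ^ α₂ / α₁ : ℝ) : ℂ) *
        (((p.1 ^ (α₁ + α₂ - 1 - 1) * Real.exp (-((α₁ / κ₁ + α₁ / κ₂ * p.2) * p.1)) : ℝ) : ℂ) *
          w p.2) := by
    rw [Measure.prod_restrict]
    filter_upwards [ae_restrict_mem (measurableSet_Ioi.prod measurableSet_Ioi)] with p hp
    exact gammaPDFReal_smul_estimatorTerm h₁ h₂ hκ₁ hκ₂ s hp.1 hp.2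
  have hF : ContinuousOn (fun p : ℝ × ℝ => (gammaPDFReal α₁ (α₁ / κ₁) p.1 *
      gammaPDFReal α₂ (α₂ / κ₂) p.2) • estimatorTerm α₁ α₂ s p.1 p.2) (Ioi 0 ×ˢ Ioi 0) := by
    refine ContinuousOn.smul (f := fun p : ℝ × ℝ => gammaPDFReal α₁ (α₁ / κ₁) p.1 *
      gammaPDFReal α₂ (α₂ / κ₂) p.2) (ContinuousOn.mul ?_ ?_) (continuousOn_estimatorTerm h₁ h₂ hs₁)
    · exact (continuousOn_gammaPDFReal _ _).comp continuousOn_fst fun p hp => hp.1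
    · exact (continuousOn_gammaPDFReal _ _).comp continuousOn_snd fun p hp => hp.2
  obtain ⟨l1, l2⟩ := integrable_and_integral_prod_of_comp_mul (div_pos h₁ h₂) hF
    ((k1.const_mul _).congr hcomp.symm)
  refine ⟨g1.2 l1, ?_⟩
  rw [g2, l2, integral_congr_ae hcomp, integral_const_mul, k2,
    setIntegral_congr_fun measurableSet_Ioi hker, integral_const_mul]
  have hst := integral_rpow_mul_binomialTail ha hb hc hc0 hζ
  have hζ1 : ((κ₂ / κ₁ : ℝ) : ℂ) - 1 ≠ 0 := fun h => hκ (by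
    have h' : κ₂ / κ₁ = 1 := by exact_mod_cast sub_eq_zero.1 h
    rw [div_eq_one_iff_eq hκ₁.ne'] at h'
    exact h'.symm)
  have hΓ : Gamma ((α₁ + α₂ - 1 : ℝ) : ℂ) ≠ 0 := Gamma_ne_zero_of_re_pos (by rwa [ofReal_re])
  have hconst : (α₁ / κ₁) ^ α₁ * (α₁ / κ₂) ^ α₂ / α₁ * (α₁ / κ₂) ^ (-(α₁ + α₂ - 1)) =
      (κ₂ / κ₁) ^ α₁ / κ₂ := by
    rw [show α₁ / κ₁ = α₁ / κ₂ * (κ₂ / κ₁) by field_simp, Real.mul_rpow hq.le hζ.le,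
      show -(α₁ + α₂ - 1) = -α₁ + -α₂ + 1 by ring, Real.rpow_add_one hq.ne', Real.rpow_add hq,
      Real.rpow_neg hq.le, Real.rpow_neg hq.le]
    have := (Real.rpow_pos_of_pos hq α₁).ne'
    have := (Real.rpow_pos_of_pos hq α₂).ne'
    field_simp
  rw [show -((α₁ : ℂ) - 1 - s) = 1 - α₁ + s by ring, eq_div_iff hΓ] at hst
  rw [← hconst, mul_div_assoc', eq_div_iff hζ1, ← hst, ← Gamma_ofReal]
  simp only [ofReal_mul]
  ring

theorem mainTheorem1 {Ω : Type*} [MeasurableSpace Ω] (P : Measure Ω) [IsProbabilityMeasure P]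
    (α₁ α₂ κ₁ κ₂ : ℝ) (hα₁ : 0 < α₁) (hα₂ : 0 < α₂) (hα : 1 < α₁ + α₂)
    (hκ₁ : 0 < κ₁) (hκ₂ : 0 < κ₂) (hκ : κ₁ ≠ κ₂)
    (Y₁ Y₂ : Ω → ℝ)
    (hY₁ : HasLaw Y₁ (gammaMeasure α₁ (α₁ / κ₁)) P)
    (hY₂ : HasLaw Y₂ (gammaMeasure α₂ (α₂ / κ₂)) P)
    (hY : IndepFun Y₁ Y₂ P)
    (ν : ℂ) (hν₁ : -α₂ < ν.re) (hν₂ : ν.re < α₁) :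
    Integrable (fun ω => estimatorT α₁ α₂ ν (Y₁ ω) (Y₂ ω)) P ∧
      ∫ ω, estimatorT α₁ α₂ ν (Y₁ ω) (Y₂ ω) ∂P =
        (1 - ((κ₂ / κ₁ : ℝ) : ℂ) ^ ν) / ((κ₁ : ℂ) - (κ₂ : ℂ)) := by
  have hlaw := hY.hasLaw_prod hY₁ hY₂
  obtain ⟨i0, e0⟩ := integrable_and_integral_estimatorTerm hα₁ hα₂ hα hκ₁ hκ₂ hκ (s := 0)
    (by simpa using hα₂) (by simpa using hα₁)
  obtain ⟨i1, e1⟩ := integrable_and_integral_estimatorTerm hα₁ hα₂ hα hκ₁ hκ₂ hκ hν₁ hν₂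
  have hae : (fun p : ℝ × ℝ => estimatorTerm α₁ α₂ 0 p.1 p.2 - estimatorTerm α₁ α₂ ν p.1 p.2)
      =ᵐ[(gammaMeasure α₁ (α₁ / κ₁)).prod (gammaMeasure α₂ (α₂ / κ₂))]
      fun p => estimatorT α₁ α₂ ν p.1 p.2 := by
    filter_upwards [ae_prod_gammaMeasure _ _ _ _] with p hp
    exact (estimatorT_eq hα₁ hα₂ hν₁ hp.1 hp.2).symm
  have hint := (i0.sub i1).congr hae
  have hint' := hint
  rw [← hlaw.map_eq] at hint'
  refine ⟨hint'.comp_aemeasurable hlaw.aemeasurable, ?_⟩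
  refine (hlaw.integral_comp hint.aestronglyMeasurable).trans ?_
  rw [← integral_congr_ae hae, integral_sub i0 i1, e0, e1]
  have hζ : 0 < κ₂ / κ₁ := by positivity
  have hζ' : ((κ₂ / κ₁ : ℝ) : ℂ) ≠ 0 := ofReal_ne_zero.2 hζ.ne'
  -- The terms `ζ^α₁` of the two means cancel; what remains of each is `ζ^α₁ ζ^(1 - α₁ + s) = ζ
  -- ζ^s`, free of `α₁`.
  have hpow : ∀ s : ℂ, (((κ₂ / κ₁) ^ α₁ : ℝ) : ℂ) * ((κ₂ / κ₁ : ℝ) : ℂ) ^ (1 - α₁ + s) =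
      ((κ₂ / κ₁ : ℝ) : ℂ) * ((κ₂ / κ₁ : ℝ) : ℂ) ^ s := fun s => by
    rw [ofReal_cpow hζ.le, ← cpow_add _ _ hζ',
      show (α₁ : ℂ) + (1 - α₁ + s) = 1 + s by ring, cpow_add _ _ hζ', cpow_one]
  have p0 := hpow 0
  have p1 := hpow ν
  rw [cpow_zero, mul_one] at p0
  rw [ofReal_div _ κ₂]
  generalize (((κ₂ / κ₁) ^ α₁ : ℝ) : ℂ) = A at *
  generalize ((κ₂ / κ₁ : ℝ) : ℂ) ^ (1 - (α₁ : ℂ) + 0) = B at *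
  generalize ((κ₂ / κ₁ : ℝ) : ℂ) ^ (1 - (α₁ : ℂ) + ν) = C at *
  generalize ((κ₂ / κ₁ : ℝ) : ℂ) ^ ν = D at *
  rw [ofReal_div] at *
  have hk1 : (κ₁ : ℂ) ≠ 0 := ofReal_ne_zero.2 hκ₁.ne'
  have hk2 : (κ₂ : ℂ) ≠ 0 := ofReal_ne_zero.2 hκ₂.ne'
  have hk : (κ₁ : ℂ) - κ₂ ≠ 0 := sub_ne_zero.2 fun h => hκ (by exact_mod_cast h)
  have hk' : (κ₂ : ℂ) / κ₁ - 1 ≠ 0 := by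
    rw [div_sub_one hk1]
    exact div_ne_zero (by rwa [← neg_sub, neg_ne_zero]) hk1
  rw [show A / κ₂ * ((1 - B) / (κ₂ / κ₁ - 1)) - A / κ₂ * ((1 - C) / (κ₂ / κ₁ - 1)) =
    (A * C - A * B) / (κ₂ * (κ₂ / κ₁ - 1)) by field_simp; ring, p0, p1,
    div_eq_div_iff (mul_ne_zero hk2 hk') hk]
  field_simp
  ring
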